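/- Let $n\ge 0$ and let $R_n$ be the rose with one vertex and $n$ petals. A marked graph $(G,g)$ is a finite graph $G$ (loops and multiple edges allowed) all of whose vertices have valence at least $3$, together with a homotopy equivalence $g\colon R_n\to G$; marked graphs $(G,g)$ and $(G',g')$ are equivalent if there is a graph isomorphism $h\colon G\to G'$ with $h\circ g\simeq g'$. A forest $F$ in $G$ is a set of edges that contains no circuit; collapsing each component of $F$ to a point gives a graph $G/\!/F$, the collapsing map $c_F\colon G\to G/\!/F$, and the marked graph $(G/\!/F, c_F\circ g)$. The equivalence classes of marked graphs are partially ordered by $y\le x$ if $y$ is obtained from $x$ by collapsing a (possibly empty) forest. The spine $K_n$ of Outer space is the geometric realization (with the weak topology) of the order complex of this poset. Let $L_n\subseteq K_n$ be the subcomplex spanned by the marked graphs that have no separating edge, i.e. no edge whose removal disconnects the graph. **Proposition.** $K_n$ deformation retracts onto $L_n$. More precisely, collapsing all separating edges, $(G,g)\mapsto (G/\!/S, c_S\circ g)$ with $S$ the set (a forest) of all separating edges of $G$, gives a well-defined order-preserving map $f$ from the set of vertices of $K_n$ to itself, with $f(x)\le x$ for every vertex $x$ and with image the set of vertices of $L_n$;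 and there is a homotopy $H\colon [0,1]\times K_n\to K_n$ with $H(0,x)=x$ and $H(1,x)\in L_n$ for all $x\in K_n$, and $H(t,x)=x$ for all $x\in L_n$ and $t\in[0,1]$, whose end map $H(1,\cdot)$ is the simplicial map $|f|$ induced by $f$. -/

import Mathlib

open Topology unitInterval

/-! ### Graphs -/

/-- A graph, loops and multiple edges allowed, given by its vertices and its *oriented* edges.
`rev` reverses the orientation, so an unoriented edge is a pair `{e, rev e}`. -/
structure OGraph where
  V : Type
  E : Type
  init : E → V
  rev : E → E
  rev_rev : ∀ e, rev (rev e) = e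
  rev_ne : ∀ e, rev e ≠ e

namespace OGraph

/-- The terminal vertex of an oriented edge. -/
def term (G : OGraph) (e : G.E) : G.V := G.init (G.rev e)

/-- The valence of a vertex: the number of oriented edges that start there
(so a loop contributes two). -/
noncomputable def valence (G : OGraph) (v : G.V) : ℕ := Nat.card {e : G.E // G.init e = v}

/-- The rose with `n` petals. -/
def rose (n : ℕ) : OGraph where
  V := Unit
  E := Fin n × Bool
  init _ := ()
  rev e := (e.1, !e.2)
  rev_rev e := by simp
  rev_ne e := by simp [Prod.ext_iff]

/-- A set of unoriented edges. Together with all the vertices it is a subgraph. -/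
structure EdgeSet (G : OGraph) where
  carrier : Set G.E
  rev_mem : ∀ e, e ∈ carrier → G.rev e ∈ carrier

/-- The end points of an edge in `S` are adjacent in the subgraph `S`. -/
def EdgeAdj (G : OGraph) (S : Set G.E) (u v : G.V) : Prop :=
  ∃ e ∈ S, G.init e = u ∧ G.term e = v

/-- `u` and `v` are joined by an edge path in `S`. -/
def Joined (G : OGraph) (S : Set G.E) : G.V → G.V → Prop := Relation.ReflTransGen (G.EdgeAdj S)

/-- `F` is a forest: it contains no circuit, that is, no nonempty closed edge path
that runs over each unoriented edge at most once. -/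
def IsForest (G : OGraph) (F : G.EdgeSet) : Prop :=
  ¬ ∃ l : List G.E, ∃ hl : l ≠ [],
    (∀ e ∈ l, e ∈ F.carrier) ∧
    l.IsChain (fun a b => G.term a = G.init b) ∧
    G.term (l.getLast hl) = G.init (l.head hl) ∧
    l.Pairwise (fun a b => b ≠ a ∧ b ≠ G.rev a)

/-- `e` is a separating edge: deleting it (that is, `e` and `rev e`, but not the end points)
separates its end points from each other. For a connected graph (and every graph homotopy equivalent
to a rose is connected) this says that deleting it disconnects the graph. -/
def IsSeparating (G : OGraph) (e : G.E) : Prop :=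
  ¬ G.Joined {a | a ≠ e ∧ a ≠ G.rev e} (G.init e) (G.term e)

theorem term_rev (G : OGraph) (e : G.E) : G.term (G.rev e) = G.init e := by
  simp [term, G.rev_rev]

theorem IsSeparating.rev {G : OGraph} {e : G.E} (h : G.IsSeparating e) :
    G.IsSeparating (G.rev e) := by
  intro hj
  apply h
  rw [term_rev] at hj
  have hset : {a | a ≠ G.rev e ∧ a ≠ G.rev (G.rev e)} = {a | a ≠ e ∧ a ≠ G.rev e} := by
    ext a
    simp [G.rev_rev, and_comm]
  rw [hset] at hj
  have hsymm : Std.Symm (G.EdgeAdj {a | a ≠ e ∧ a ≠ G.rev e}) := by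
    constructor
    rintro u v ⟨a, ⟨ha, ha'⟩, hu, hv⟩
    refine ⟨G.rev a, ⟨fun hh => ha' ?_, fun hh => ha ?_⟩, hv, (G.term_rev a).trans hu⟩
    · rw [← hh, G.rev_rev]
    · rw [← G.rev_rev a, hh, G.rev_rev]
  exact Relation.ReflTransGen.stdSymm.symm _ _ hj

/-- The set of all separating edges. -/
def sepEdges (G : OGraph) : G.EdgeSet where
  carrier := {e | G.IsSeparating e}
  rev_mem _ h := h.rev

/-- The graph `G // F`: each connected component of the subgraph `F` is collapsed to a vertex,
and the edges are those outside `F`. -/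
def collapse (G : OGraph) (F : G.EdgeSet) : OGraph where
  V := Quot (G.EdgeAdj F.carrier)
  E := {e : G.E // e ∉ F.carrier}
  init e := Quot.mk _ (G.init e.1)
  rev e := ⟨G.rev e.1, fun h => e.2 (by simpa [G.rev_rev] using F.rev_mem _ h)⟩
  rev_rev e := Subtype.ext (G.rev_rev e.1)
  rev_ne e h := G.rev_ne e.1 (congrArg Subtype.val h)

/-- The vertex of `G // F` to which a vertex of `G` is sent. -/
def collapseV (G : OGraph) (F : G.EdgeSet) (v : G.V) : (G.collapse F).V :=
  Quot.mk (G.EdgeAdj F.carrier) v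

/-- The edge of `G // F` given by an edge of `G` outside `F`. -/
def collapseE (G : OGraph) (F : G.EdgeSet) (e : G.E) (h : e ∉ F.carrier) : (G.collapse F).E :=
  Subtype.mk e h

theorem collapseV_eq (G : OGraph) (F : G.EdgeSet) {e : G.E} (h : e ∈ F.carrier) :
    G.collapseV F (G.init e) = G.collapseV F (G.init (G.rev e)) :=
  Quot.sound ⟨e, h, rfl, rfl⟩

theorem init_collapseE (G : OGraph) (F : G.EdgeSet) (e : G.E) (h : e ∉ F.carrier) :
    (G.collapse F).init (G.collapseE F e h) = G.collapseV F (G.init e) := rfl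

theorem rev_collapseE (G : OGraph) (F : G.EdgeSet) (e : G.E) (h : e ∉ F.carrier)
    (h' : G.rev e ∉ F.carrier) :
    (G.collapse F).rev (G.collapseE F e h) = G.collapseE F (G.rev e) h' := rfl

/-- Isomorphisms of graphs. -/
structure Iso (G H : OGraph) where
  onV : G.V ≃ H.V
  onE : G.E ≃ H.E
  init_onE : ∀ e, H.init (onE e) = onV (G.init e)
  rev_onE : ∀ e, H.rev (onE e) = onE (G.rev e)

def Iso.refl (G : OGraph) : Iso G G := ⟨Equiv.refl _, Equiv.refl _, fun _ => rfl, fun _ => rfl⟩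

def Iso.symm {G H : OGraph} (h : Iso G H) : Iso H G where
  onV := h.onV.symm
  onE := h.onE.symm
  init_onE e := by
    rw [Equiv.eq_symm_apply, ← h.init_onE, Equiv.apply_symm_apply]
  rev_onE e := by
    rw [Equiv.eq_symm_apply, ← h.rev_onE, Equiv.apply_symm_apply]

def Iso.trans {G H K : OGraph} (h : Iso G H) (k : Iso H K) : Iso G K where
  onV := h.onV.trans k.onV
  onE := h.onE.trans k.onE
  init_onE e := by simp [h.init_onE, k.init_onE]
  rev_onE e := by simp [h.rev_onE, k.rev_onE]

/-! ### The topological space of a graph -/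

/-- Vertices and edges are discrete sets. -/
instance (G : OGraph) : TopologicalSpace G.V := ⊥
instance (G : OGraph) : DiscreteTopology G.V := ⟨rfl⟩
instance (G : OGraph) : TopologicalSpace G.E := ⊥
instance (G : OGraph) : DiscreteTopology G.E := ⟨rfl⟩

/-- In the disjoint union of the vertices and of one unit interval for each oriented edge, the
interval of `e` starts at the vertex `init e`, and is the interval of `rev e` run backwards. -/
inductive Glue (G : OGraph) : G.V ⊕ (G.E × I) → G.V ⊕ (G.E × I) → Prop
  | init (e : G.E) : Glue G (Sum.inr (e, 0)) (Sum.inl (G.init e))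
  | rev (e : G.E) (t : I) : Glue G (Sum.inr (e, t)) (Sum.inr (G.rev e, σ t))

/-- The topological space (one-dimensional CW complex) of a graph. -/
def Space (G : OGraph) : Type := Quot (Glue G)

instance (G : OGraph) : TopologicalSpace G.Space :=
  inferInstanceAs (TopologicalSpace (Quot (Glue G)))

/-- The point of the space given by a vertex. -/
def vertexPt (G : OGraph) (v : G.V) : G.Space := Quot.mk _ (Sum.inl v)

/-- The point at time `t` on an oriented edge. -/
def edgePt (G : OGraph) (e : G.E) (t : I) : G.Space := Quot.mk _ (Sum.inr (e, t))

theorem edgePt_zero (G : OGraph) (e : G.E) : G.edgePt e 0 = G.vertexPt (G.init e) :=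
  Quot.sound (Glue.init e)

theorem edgePt_rev (G : OGraph) (e : G.E) (t : I) : G.edgePt e t = G.edgePt (G.rev e) (σ t) :=
  Quot.sound (Glue.rev e t)

theorem edgePt_one (G : OGraph) (e : G.E) : G.edgePt e 1 = G.vertexPt (G.term e) := by
  rw [edgePt_rev, unitInterval.symm_one, edgePt_zero]; rfl

theorem continuous_vertexPt (G : OGraph) : Continuous G.vertexPt := continuous_of_discreteTopology

theorem continuous_edgePt (G : OGraph) (e : G.E) : Continuous (G.edgePt e) :=
  continuous_quot_mk.comp (continuous_inr.comp (by fun_prop))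

theorem space_cases (G : OGraph) (x : G.Space) :
    (∃ v, x = G.vertexPt v) ∨ ∃ e t, x = G.edgePt e t := by
  obtain ⟨v | ⟨e, t⟩, rfl⟩ := Quot.exists_rep x
  · exact Or.inl ⟨v, rfl⟩
  · exact Or.inr ⟨e, t, rfl⟩

/-- The continuous map on the space of a graph which is prescribed on vertices and on edges. -/
def desc (G : OGraph) {X : Type*} [TopologicalSpace X] (fV : G.V → X) (fE : G.E → I → X)
    (hc : ∀ e, Continuous (fE e)) (h0 : ∀ e, fE e 0 = fV (G.init e))
    (hr : ∀ e t, fE e t = fE (G.rev e) (σ t)) : C(G.Space, X) where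
  toFun := Quot.lift (Sum.elim fV (fun p => fE p.1 p.2)) (by
    rintro _ _ (e | ⟨e, t⟩)
    · exact h0 e
    · exact hr e t)
  continuous_toFun := continuous_quot_lift _ (Continuous.sumElim continuous_of_discreteTopology
    (continuous_prod_of_discrete_left.mpr hc))

/-- The homeomorphism of spaces induced by an isomorphism of graphs (as a continuous map);
it is isometric on each edge. -/
def Iso.map {G H : OGraph} (h : Iso G H) : C(G.Space, H.Space) :=
  G.desc (fun v => H.vertexPt (h.onV v)) (fun e t => H.edgePt (h.onE e) t)
    (fun e => H.continuous_edgePt (h.onE e))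
    (fun e => by rw [edgePt_zero, h.init_onE])
    (fun e t => by rw [edgePt_rev, h.rev_onE])

open Classical in
/-- The collapsing map `c_F : G → G // F`. It sends an edge in `F` to a vertex and is isometric on
each edge outside `F`. -/
noncomputable def collapseMap (G : OGraph) (F : G.EdgeSet) : C(G.Space, (G.collapse F).Space) :=
  G.desc (fun v => (G.collapse F).vertexPt (G.collapseV F v))
    (fun e t => if h : e ∈ F.carrier then (G.collapse F).vertexPt (G.collapseV F (G.init e))
      else (G.collapse F).edgePt (G.collapseE F e h) t)
    (fun e => by
      by_cases h : e ∈ F.carrier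
      · simp only [h, dite_true]; exact continuous_const
      · simp only [h, dite_false]; exact (G.collapse F).continuous_edgePt (G.collapseE F e h))
    (fun e => by
      by_cases h : e ∈ F.carrier
      · simp only [h, dite_true]
      · simp only [h, dite_false]; rw [edgePt_zero, init_collapseE])
    (fun e t => by
      by_cases h : e ∈ F.carrier
      · have h' := F.rev_mem e h
        simp only [h, h', dite_true]
        rw [collapseV_eq G F h]
      · have h' : G.rev e ∉ F.carrier := fun h' => h (by simpa [G.rev_rev] using F.rev_mem _ h')
        simp only [h, h', dite_false]
        rw [edgePt_rev, rev_collapseE])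

theorem Iso.map_refl (G : OGraph) : (Iso.refl G).map = ContinuousMap.id _ := by
  ext x
  rcases G.space_cases x with ⟨v, rfl⟩ | ⟨e, t, rfl⟩ <;> rfl

theorem Iso.map_trans {G H K : OGraph} (h : Iso G H) (k : Iso H K) :
    (h.trans k).map = k.map.comp h.map := by
  ext x
  rcases G.space_cases x with ⟨v, rfl⟩ | ⟨e, t, rfl⟩ <;> rfl

theorem Iso.symm_map_comp {G H : OGraph} (h : Iso G H) :
    h.symm.map.comp h.map = ContinuousMap.id _ := by
  rw [← Iso.map_trans, ← Iso.map_refl]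
  have : h.trans h.symm = Iso.refl G := by
    simp [Iso.trans, Iso.symm, Iso.refl]
  rw [this]

end OGraph

/-! ### Marked graphs and the spine of Outer space -/

/-- A finite graph with all valences at least `3`, with a homotopy equivalence from the rose. -/
structure MarkedGraph (n : ℕ) where
  graph : OGraph
  finite_V : Finite graph.V
  finite_E : Finite graph.E
  three_le_valence : ∀ v, 3 ≤ graph.valence v
  marking : C((OGraph.rose n).Space, graph.Space)
  marking_equiv : ∃ e : ContinuousMap.HomotopyEquiv (OGraph.rose n).Space graph.Space,
    e.toFun = marking

namespace MarkedGraph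

/-- `(G, g)` and `(G', g')` are equivalent if some isomorphism `h : G → G'` has `h ∘ g ≃ g'`. -/
instance setoid (n : ℕ) : Setoid (MarkedGraph n) where
  r X Y := ∃ h : OGraph.Iso X.graph Y.graph, (h.map.comp X.marking).Homotopic Y.marking
  iseqv :=
    { refl := fun X => ⟨OGraph.Iso.refl _, by
        rw [OGraph.Iso.map_refl, ContinuousMap.id_comp]⟩
      symm := by
        rintro X Y ⟨h, hh⟩
        refine ⟨h.symm, ?_⟩
        have h1 := ContinuousMap.Homotopic.comp
          (ContinuousMap.Homotopic.refl h.symm.map) hh.symm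
        rwa [← ContinuousMap.comp_assoc, OGraph.Iso.symm_map_comp,
          ContinuousMap.id_comp] at h1
      trans := by
        rintro X Y Z ⟨h, hh⟩ ⟨k, hk⟩
        refine ⟨h.trans k, ?_⟩
        rw [OGraph.Iso.map_trans, ContinuousMap.comp_assoc]
        exact (ContinuousMap.Homotopic.comp (ContinuousMap.Homotopic.refl k.map) hh).trans hk }

/-- `Y` is, up to equivalence of marked graphs, the marked graph `(G // F, c_F ∘ g)` that is
obtained from `X = (G, g)` by collapsing the forest `F`. -/
def IsForestCollapse {n : ℕ} (X : MarkedGraph n) (F : X.graph.EdgeSet) (Y : MarkedGraph n) : Prop :=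
  X.graph.IsForest F ∧ ∃ h : OGraph.Iso (X.graph.collapse F) Y.graph,
    ((h.map.comp (X.graph.collapseMap F)).comp X.marking).Homotopic Y.marking

end MarkedGraph

/-- The vertices of the spine: equivalence classes of marked graphs. -/
def SpineVertex (n : ℕ) : Type 1 := Quotient (MarkedGraph.setoid n)

/-- The equivalence class of a marked graph. -/
def MarkedGraph.toVertex {n : ℕ} (X : MarkedGraph n) : SpineVertex n := Quotient.mk _ X

/-- The partial order on the vertices of the spine: `y ≤ x` if `y` is obtained from `x` by
collapsing a (possibly empty) forest. -/
instance (n : ℕ) : LE (SpineVertex n) where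
  le y x := ∃ X Y : MarkedGraph n, X.toVertex = x ∧ Y.toVertex = y ∧ ∃ F, X.IsForestCollapse F Y

/-- The vertices of the spine given by marked graphs without separating edges. -/
def nonsepVertices (n : ℕ) : Set (SpineVertex n) :=
  {x | ∃ X : MarkedGraph n, X.toVertex = x ∧ ∀ e, ¬ X.graph.IsSeparating e}

/-! ### Simplicial complexes and their geometric realizations -/

/-- The order complex: the simplices are the finite nonempty chains. -/
def orderComplex (P : Type*) [LE P] : AbstractSimplicialComplex P where
  faces := {s | s.Nonempty ∧ IsChain (· ≤ ·) (s : Set P)}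
  isRelLowerSet_faces := fun _ hs =>
    ⟨hs.1, fun _ hts ht => ⟨ht, hs.2.mono (Finset.coe_subset.mpr hts)⟩⟩
  singleton_mem p := ⟨Finset.singleton_nonempty p, by simp⟩

/-- The points of the geometric realization of a simplicial complex, in barycentric coordinates. -/
@[ext]
structure Realization {ι : Type*} (K : AbstractSimplicialComplex ι) where
  weight : ι →₀ ℝ
  nonneg : ∀ i, 0 ≤ weight i
  sum_eq_one : (weight.sum fun _ a => a) = 1
  support_mem : weight.support ∈ K.faces

/-- The weak topology: a set is open if and only if its intersection with each closed simplex is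
open in that simplex, which carries the topology of the barycentric coordinates. -/
instance {ι : Type*} (K : AbstractSimplicialComplex ι) : TopologicalSpace (Realization K) :=
  ⨆ s ∈ K.faces, TopologicalSpace.coinduced
    (Subtype.val : {x : Realization K // x.weight.support ⊆ s} → Realization K)
    (TopologicalSpace.induced (fun x => (⇑x.1.weight : ι → ℝ)) inferInstance)

/-- The (realization of the) subcomplex spanned by a set `A` of vertices: it consists of the
simplices all of whose vertices lie in `A`. -/
def spannedSubcomplex {ι : Type*} (K : AbstractSimplicialComplex ι) (A : Set ι) :
    Set (Realization K) :=
  {x | (x.weight.support : Set ι) ⊆ A}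

/-- A deformation retraction (in the strong sense: the points of `A` do not move) of a space `X`
onto a subset `A`. -/
structure DeformationRetraction (X : Type*) [TopologicalSpace X] (A : Set X) where
  H : C(I × X, X)
  at_zero : ∀ x, H (0, x) = x
  at_one_mem : ∀ x, H (1, x) ∈ A
  fixed : ∀ t, ∀ a ∈ A, H (t, a) = a

/-- The spine `K_n` of Outer space, as a topological space. -/
abbrev Spine (n : ℕ) : Type 1 := Realization (orderComplex (SpineVertex n))

/-- The subcomplex `L_n` of `K_n` spanned by the marked graphs without separating edges. -/
def nonsepSpine (n : ℕ) : Set (Spine n) := spannedSubcomplex _ (nonsepVertices n)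

namespace OGraph

/-! ### Edge paths, forests and separating edges -/

variable {G H K : OGraph}

/-! The combinatorial core is that separating edges behave well under collapsing: an edge surviving
in `G // F` is separating exactly when it is separating in `G` (`Coll.isSeparating_iff`), because an
edge path in the quotient lifts to `G` once paths inside `F` are inserted (`Coll.joined_iff`).
Separating edges lie on no circuit, so they form a forest. If `X` collapses to `Y`, the composite
collapse of `X` onto `Y` with its separating edges collapsed kills all separating edges of `X`;
hence it factors through the collapse of just those (`Coll.exists_factor`), which gives
monotonicity. The same comparison with equal kernels gives independence of the representative. To
avoid working in iterated quotients, a collapse is recorded as data `Coll` (kernel, vertex map, lift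
of the surviving edges), which compose and factor on the nose.

That a collapsed graph is again a marked graph is proved one edge at a time: contracting a non-loop
is a homotopy equivalence with an explicit inverse (`exists_homotopyEquiv_contract`) and keeps all
valences at least 3; `exists_coll` is the induction.

The topological part concerns any monotone `f ≤ id` fixing its image. The straight-line homotopy
from the identity to `|f|` may leave the complex: for `p < q` the elements `p` and `f q` need not be
comparable. Instead the weight at each vertex of a chain slides to its image in order of height,
lowest first, where height is the number of vertices of the graph. A moved `f p'` is then compared
only with an unmoved `p` of at least the same height, and `f p' ≤ p' ≤ p`, so supports stay chains
(`slide_support_mem`). Vertices fixed by `f` do not move. Joint continuity is checked on closed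
simplices after currying the time variable (`exists_deformationRetraction`). -/

theorem rev_injective (G : OGraph) : Function.Injective G.rev :=
  Function.LeftInverse.injective G.rev_rev

theorem Joined.mono {S T : Set G.E} (h : S ⊆ T) {u v : G.V} (huv : G.Joined S u v) :
    G.Joined T u v :=
  Relation.ReflTransGen.mono (fun _ _ ⟨e, he, hu, hv⟩ => ⟨e, h he, hu, hv⟩) _ _ huv

theorem Joined.of_mem {S : Set G.E} {e : G.E} (he : e ∈ S) : G.Joined S (G.init e) (G.term e) :=
  Relation.ReflTransGen.single ⟨e, he, rfl, rfl⟩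

theorem Joined.symm {S : Set G.E} (hS : ∀ e, e ∈ S → G.rev e ∈ S) {u v : G.V}
    (h : G.Joined S u v) : G.Joined S v u := by
  induction h with
  | refl => exact Relation.ReflTransGen.refl
  | tail _ hbc ih =>
    obtain ⟨e, he, rfl, rfl⟩ := hbc
    exact Relation.ReflTransGen.head ⟨G.rev e, hS e he, rfl, G.term_rev e⟩ ih

/-- `l` is an edge path from `u` to `v`. -/
def IsPath (G : OGraph) : G.V → List G.E → G.V → Prop
  | u, [], v => u = v
  | u, e :: l, v => G.init e = u ∧ IsPath G (G.term e) l v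

theorem isPath_append {l₁ l₂ : List G.E} {u w : G.V} :
    G.IsPath u (l₁ ++ l₂) w ↔ ∃ v, G.IsPath u l₁ v ∧ G.IsPath v l₂ w := by
  induction l₁ generalizing u with
  | nil => simp [IsPath]
  | cons e l ih => simp [IsPath, ih, and_assoc]

theorem IsPath.joined {S : Set G.E} {l : List G.E} {u v : G.V} (h : G.IsPath u l v)
    (hl : ∀ e ∈ l, e ∈ S) : G.Joined S u v := by
  induction l generalizing u with
  | nil => obtain rfl : u = v := h; exact Relation.ReflTransGen.refl
  | cons e l ih =>
    obtain ⟨rfl, h⟩ := h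
    exact (Joined.of_mem (hl e (by simp))).trans (ih h fun a ha => hl a (by simp [ha]))

/-- Translates between the recursive form of edge paths, suited to induction, and the list form used
in `IsForest`. -/
theorem isPath_cons_iff {l : List G.E} {e : G.E} {v : G.V} :
    G.IsPath (G.init e) (e :: l) v ↔ (e :: l).IsChain (fun a b => G.term a = G.init b) ∧
      G.term ((e :: l).getLast (by simp)) = v := by
  induction l generalizing e with
  | nil => simp [IsPath]
  | cons b l ih =>
    have h1 : G.IsPath (G.init e) (e :: b :: l) v ↔
        G.term e = G.init b ∧ G.IsPath (G.init b) (b :: l) v := by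
      simp only [IsPath, true_and, eq_comm]
    rw [h1, ih, List.isChain_cons_cons, and_assoc, List.getLast_cons (List.cons_ne_nil b l)]

theorem IsPath.term_mem {l : List G.E} {u v : G.V} (h : G.IsPath u l v) {b : G.E} (hb : b ∈ l) :
    G.term b = v ∨ ∃ c ∈ l, G.init c = G.term b := by
  induction l generalizing u with
  | nil => simp at hb
  | cons e l ih =>
    obtain ⟨-, h⟩ := h
    rcases List.mem_cons.1 hb with rfl | hb
    · cases l with
      | nil => exact Or.inl h
      | cons c l => exact Or.inr ⟨c, by simp, h.1⟩
    · rcases ih h hb with h' | ⟨c, hc, h'⟩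
      · exact Or.inl h'
      · exact Or.inr ⟨c, by simp [hc], h'⟩

/-- Joined vertices are joined by an edge path which visits no vertex twice. -/
theorem Joined.exists_isPath {S : Set G.E} {u v : G.V} (h : G.Joined S u v) :
    ∃ l, G.IsPath u l v ∧ (∀ e ∈ l, e ∈ S) ∧ l.Pairwise (fun a b => G.init b ≠ G.init a) ∧
      ∀ a ∈ l, G.init a ≠ v := by
  induction h using Relation.ReflTransGen.head_induction_on with
  | refl => exact ⟨[], rfl, by simp⟩
  | head hab _ ih =>
    obtain ⟨c, hc, rfl, rfl⟩ := hab
    obtain ⟨l, hl, hlS, hp, hv⟩ := ih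
    by_cases huv : G.init c = v
    · exact ⟨[], huv, by simp⟩
    -- If the path already visits the new starting vertex, the detour is cut off: keep only the part
    -- from that visit on.
    by_cases hu : ∃ b ∈ l, G.init b = G.init c
    · obtain ⟨b, hb, hbc⟩ := hu
      obtain ⟨l₁, l₂, rfl⟩ := List.append_of_mem hb
      obtain ⟨w, -, hw, hw'⟩ := isPath_append.1 hl
      exact ⟨b :: l₂, ⟨hbc, hw'⟩, fun e he => hlS e (List.mem_append_right _ he),
        (List.pairwise_append.1 hp).2.1, fun a ha => hv a (List.mem_append_right _ ha)⟩
    · push Not at hu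
      refine ⟨c :: l, ⟨rfl, hl⟩, ?_, List.pairwise_cons.2 ⟨hu, hp⟩, ?_⟩ <;>
        simp_all

/-- Repeating an edge repeats its initial vertex, and a later `rev e` returns to `init e`, which
would then be the end of the path or the start of a later edge. -/
theorem IsPath.pairwise_ne {l : List G.E} {u v : G.V} (h : G.IsPath u l v)
    (hp : l.Pairwise (fun a b => G.init b ≠ G.init a)) (hv : ∀ a ∈ l, G.init a ≠ v) :
    l.Pairwise (fun a b => b ≠ a ∧ b ≠ G.rev a) := by
  induction l generalizing u with
  | nil => exact List.Pairwise.nil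
  | cons e l ih =>
    obtain ⟨-, h⟩ := h
    obtain ⟨hp₁, hp₂⟩ := List.pairwise_cons.1 hp
    refine List.pairwise_cons.2 ⟨fun b hb => ⟨?_, ?_⟩, ih h hp₂ fun a ha => hv a (by simp [ha])⟩
    · rintro rfl
      exact hp₁ b hb rfl
    · rintro rfl
      rcases h.term_mem hb with h' | ⟨c, hc, h'⟩
      · exact hv e (by simp) (by rw [← h', term_rev])
      · exact hp₁ c hc (by rw [h', term_rev])

/-- The set `S` without the unoriented edge of `e`. -/
def without (G : OGraph) (S : Set G.E) (e : G.E) : Set G.E := {a | a ∈ S ∧ a ≠ e ∧ a ≠ G.rev e}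

theorem without_rev_mem {S : Set G.E} (hS : ∀ e, e ∈ S → G.rev e ∈ S) (e : G.E) :
    ∀ a, a ∈ G.without S e → G.rev a ∈ G.without S e := fun a ha =>
  ⟨hS a ha.1, fun h => ha.2.2 (by rw [← h, rev_rev]), fun h => ha.2.1 (G.rev_injective h)⟩

/-- The end points of an edge of a circuit are joined by the rest of the circuit. -/
theorem joined_of_circuit {F : G.EdgeSet} {l : List G.E} (hl : l ≠ [])
    (hF : ∀ e ∈ l, e ∈ F.carrier) (hc : l.IsChain (fun a b => G.term a = G.init b))
    (hlast : G.term (l.getLast hl) = G.init (l.head hl))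
    (hp : l.Pairwise (fun a b => b ≠ a ∧ b ≠ G.rev a)) {e : G.E} (he : e ∈ l) :
    G.Joined (G.without F.carrier e) (G.init e) (G.term e) := by
  have hpath : ∃ u, G.IsPath u l u := by
    cases l with
    | nil => exact absurd rfl hl
    | cons b l => exact ⟨G.init b, isPath_cons_iff.2 ⟨hc, hlast⟩⟩
  obtain ⟨u, hu⟩ := hpath
  obtain ⟨l₁, l₂, rfl⟩ := List.append_of_mem he
  obtain ⟨w, hw₁, rfl, hw₂⟩ := isPath_append.1 hu
  obtain ⟨-, hp₂, hp₁⟩ := List.pairwise_append.1 hp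
  -- Travel the circuit the other way: from `term e` on to the base point, then from there up to
  -- `init e`.
  refine Joined.symm (without_rev_mem F.rev_mem e) ((hw₂.joined ?_).trans (hw₁.joined ?_))
  · intro b hb
    exact ⟨hF b (by simp [hb]), (List.pairwise_cons.1 hp₂).1 b hb⟩
  · intro b hb
    have h := hp₁ b hb e (by simp)
    exact ⟨hF b (by simp [hb]), h.1.symm, fun h' => h.2 (by rw [h', rev_rev])⟩

/-- A path between the ends of `e` that avoids `e`, once made vertex-simple, closes up with `rev e`
to a circuit. This connectivity form is the one that passes through collapses. -/
theorem isForest_iff {F : G.EdgeSet} : G.IsForest F ↔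
    ∀ e ∈ F.carrier, ¬ G.Joined (G.without F.carrier e) (G.init e) (G.term e) := by
  constructor
  · intro hF e he hj
    obtain ⟨l, hl, hlS, hp, hv⟩ := hj.exists_isPath
    have hpath : G.IsPath (G.init (G.rev e)) (G.rev e :: l) (G.term e) :=
      ⟨rfl, by rwa [term_rev]⟩
    obtain ⟨hc, hlast⟩ := isPath_cons_iff.1 hpath
    refine hF ⟨G.rev e :: l, by simp, ?_, hc, hlast, List.pairwise_cons.2 ⟨?_, ?_⟩⟩
    · intro b hb
      rcases List.mem_cons.1 hb with rfl | hb
      · exact F.rev_mem e he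
      · exact (hlS b hb).1
    · intro b hb
      rw [rev_rev]
      exact (hlS b hb).2.symm
    · exact hl.pairwise_ne hp hv
  · rintro h ⟨l, hl, hlF, hc, hlast, hp⟩
    exact h _ (hlF _ (List.head_mem hl)) (joined_of_circuit hl hlF hc hlast hp (List.head_mem hl))

/-- Puts separation in the same form as `isForest_iff`, with all edges in place of the forest, so
that one transport lemma serves both. -/
theorem isSeparating_iff {e : G.E} :
    G.IsSeparating e ↔ ¬ G.Joined (G.without Set.univ e) (G.init e) (G.term e) := by
  simp [IsSeparating, without]

theorem isForest_sepEdges (G : OGraph) : G.IsForest G.sepEdges :=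
  by
  refine isForest_iff.2 fun e he hj => ?_
  have he : G.IsSeparating e := he
  have hsub : G.without G.sepEdges.carrier e ⊆ G.without Set.univ e := fun _ ha =>
    ⟨trivial, ha.2⟩
  exact isSeparating_iff.1 he (hj.mono hsub)

theorem IsForest.init_ne_term {F : G.EdgeSet} (hF : G.IsForest F) {e : G.E}
    (he : e ∈ F.carrier) : G.init e ≠ G.term e := fun h =>
  isForest_iff.1 hF e he (h ▸ Relation.ReflTransGen.refl)

theorem EdgeSet.ext {F F' : G.EdgeSet} (h : ∀ e, e ∈ F.carrier ↔ e ∈ F'.carrier) : F = F' := by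
  cases F; cases F'
  simpa using Set.ext h

/-! ### Collapses -/

/-- The combinatorial data that identify `H` with the graph obtained from `G` by collapsing
the subgraph `ker`. -/
@[ext]
structure Coll (G H : OGraph) where
  ker : G.EdgeSet
  onV : G.V → H.V
  lift : H.E → G.E
  lift_injective : Function.Injective lift
  exists_lift : ∀ e, e ∉ ker.carrier → ∃ e', lift e' = e
  lift_notMem : ∀ e', lift e' ∉ ker.carrier
  onV_init_lift : ∀ e', onV (G.init (lift e')) = H.init e'
  rev_lift : ∀ e', G.rev (lift e') = lift (H.rev e')
  onV_surjective : Function.Surjective onV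
  onV_eq : ∀ u v, onV u = onV v ↔ G.Joined ker.carrier u v

namespace Coll

theorem onV_term_lift (q : Coll G H) (e' : H.E) : q.onV (G.term (q.lift e')) = H.term e' := by
  rw [term, q.rev_lift, q.onV_init_lift]; rfl

/-- The quotient uses the generated equivalence relation; since `F` is closed under reversal,
joinedness is already symmetric. -/
theorem collapseV_eq_iff {F : G.EdgeSet} {u v : G.V} :
    G.collapseV F u = G.collapseV F v ↔ G.Joined F.carrier u v := by
  constructor
  · intro h
    replace h := Quot.eqvGen_exact h
    induction h with
    | rel _ _ h => exact Relation.ReflTransGen.single h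
    | refl => exact Relation.ReflTransGen.refl
    | symm _ _ _ ih => exact ih.symm F.rev_mem
    | trans _ _ _ _ _ ih ih' => exact ih.trans ih'
  · intro h
    induction h with
    | refl => rfl
    | tail _ hbc ih => exact ih.trans (Quot.sound hbc)

/-- The edges of a collapsed graph are the edges that are not collapsed. -/
noncomputable def edgeEquiv (q : Coll G H) : H.E ≃ (G.collapse q.ker).E :=
  Equiv.ofBijective (fun e' => G.collapseE q.ker (q.lift e') (q.lift_notMem e'))
    ⟨fun _ _ h => q.lift_injective (congrArg Subtype.val h), fun e => by
      obtain ⟨e', h⟩ := q.exists_lift e.1 e.2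
      exact ⟨e', Subtype.ext h⟩⟩

/-- The graph isomorphism given by the data of a collapse. -/
noncomputable def toIso (q : Coll G H) : Iso (G.collapse q.ker) H where
  onV := Equiv.ofBijective (Quot.lift q.onV fun u v h =>
      (q.onV_eq u v).2 (Relation.ReflTransGen.single h)) ⟨by
    rintro ⟨u⟩ ⟨v⟩ h
    exact collapseV_eq_iff.2 ((q.onV_eq u v).1 h), fun x => by
    obtain ⟨u, rfl⟩ := q.onV_surjective x
    exact ⟨Quot.mk _ u, rfl⟩⟩
  onE := q.edgeEquiv.symm
  init_onE e := by
    obtain ⟨e', rfl⟩ := q.edgeEquiv.surjective e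
    rw [Equiv.symm_apply_apply]
    exact (q.onV_init_lift e').symm
  rev_onE e := by
    obtain ⟨e', rfl⟩ := q.edgeEquiv.surjective e
    rw [Equiv.symm_apply_apply, Equiv.eq_symm_apply]
    exact Subtype.ext (q.rev_lift e').symm

/-- The map of spaces given by the data of a collapse. -/
noncomputable def map (q : Coll G H) : C(G.Space, H.Space) :=
  q.toIso.map.comp (G.collapseMap q.ker)

theorem map_vertexPt (q : Coll G H) (v : G.V) : q.map (G.vertexPt v) = H.vertexPt (q.onV v) := rfl

theorem map_edgePt_of_mem (q : Coll G H) {e : G.E} (he : e ∈ q.ker.carrier) (t : I) :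
    q.map (G.edgePt e t) = H.vertexPt (q.onV (G.init e)) := by
  have h : G.collapseMap q.ker (G.edgePt e t) =
      (G.collapse q.ker).vertexPt (G.collapseV q.ker (G.init e)) := dif_pos he
  exact congrArg q.toIso.map h

theorem map_edgePt_lift (q : Coll G H) (e' : H.E) (t : I) :
    q.map (G.edgePt (q.lift e') t) = H.edgePt e' t := by
  have h : G.collapseMap q.ker (G.edgePt (q.lift e') t) =
      (G.collapse q.ker).edgePt ⟨q.lift e', q.lift_notMem e'⟩ t := dif_neg (q.lift_notMem e')
  refine (congrArg q.toIso.map h).trans ?_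
  exact congrArg (fun e => H.edgePt e t) (q.edgeEquiv.symm_apply_apply e')

/-- A map that behaves like `q` on vertices and edges is `q.map`. -/
theorem map_unique (q : Coll G H) {φ : C(G.Space, H.Space)}
    (hV : ∀ v, φ (G.vertexPt v) = H.vertexPt (q.onV v))
    (hk : ∀ e ∈ q.ker.carrier, ∀ t, φ (G.edgePt e t) = H.vertexPt (q.onV (G.init e)))
    (hE : ∀ e' t, φ (G.edgePt (q.lift e') t) = H.edgePt e' t) : φ = q.map := by
  ext x
  rcases G.space_cases x with ⟨v, rfl⟩ | ⟨e, t, rfl⟩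
  · rw [hV, map_vertexPt]
  · by_cases he : e ∈ q.ker.carrier
    · rw [hk e he, map_edgePt_of_mem q he]
    · obtain ⟨e', rfl⟩ := q.exists_lift e he
      rw [hE, map_edgePt_lift]

/-- The data of the collapsing map followed by an isomorphism. -/
def ofCollapseIso {F : G.EdgeSet} (h : Iso (G.collapse F) H) : Coll G H where
  ker := F
  onV v := h.onV (G.collapseV F v)
  lift e := (h.onE.symm e).1
  lift_injective _ _ hh := h.onE.symm.injective (Subtype.ext hh)
  exists_lift e he := ⟨h.onE (G.collapseE F e he),
    congrArg Subtype.val (h.onE.symm_apply_apply (G.collapseE F e he))⟩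
  lift_notMem e := (h.onE.symm e).2
  onV_init_lift e := by
    have := h.init_onE (h.onE.symm e)
    rw [Equiv.apply_symm_apply] at this
    exact this.symm
  rev_lift e := congrArg Subtype.val (h.symm.rev_onE e)
  onV_surjective := h.onV.surjective.comp Quot.mk_surjective
  onV_eq u v := h.onV.injective.eq_iff.trans collapseV_eq_iff

theorem map_ofCollapseIso {F : G.EdgeSet} (h : Iso (G.collapse F) H) :
    h.map.comp (G.collapseMap F) = (ofCollapseIso h).map := by
  refine map_unique _ (fun v => rfl) (fun e he t => ?_) (fun e' t => ?_)
  · exact congrArg h.map (show G.collapseMap F (G.edgePt e t) = _ from dif_pos he)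
  · refine (congrArg h.map (show G.collapseMap F (G.edgePt (h.onE.symm e').1 t) = _ from
      dif_neg (h.onE.symm e').2)).trans ?_
    exact congrArg (fun e => H.edgePt e t) (h.onE.apply_symm_apply e')

theorem joined_empty {S : Set G.E} (hS : ∀ e, e ∉ S) {u v : G.V} : G.Joined S u v ↔ u = v := by
  constructor
  · intro h
    induction h with
    | refl => rfl
    | tail _ hbc => exact absurd hbc.choose_spec.1 (hS _)
  · rintro rfl
    exact Relation.ReflTransGen.refl

/-- An isomorphism is a collapse of the empty forest. -/
def ofIso (h : Iso G H) : Coll G H where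
  ker := ⟨∅, by simp⟩
  onV := h.onV
  lift := h.onE.symm
  lift_injective := h.onE.symm.injective
  exists_lift e _ := ⟨h.onE e, by simp⟩
  lift_notMem := by simp
  onV_init_lift e := by rw [← h.init_onE, Equiv.apply_symm_apply]
  rev_lift e := h.symm.rev_onE e
  onV_surjective := h.onV.surjective
  onV_eq u v := by rw [joined_empty (by simp), h.onV.injective.eq_iff]

theorem map_ofIso (h : Iso G H) : h.map = (ofIso h).map := by
  refine map_unique _ (fun v => rfl) (fun e he => absurd he (by simp [ofIso])) (fun e' t => ?_)
  exact congrArg (fun e => H.edgePt e t) (h.onE.apply_symm_apply e')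

theorem lift_bijective (q : Coll G H) (hq : ∀ e, e ∉ q.ker.carrier) : Function.Bijective q.lift :=
  ⟨q.lift_injective, fun e => q.exists_lift e (hq e)⟩

/-- A collapse of the empty forest is an isomorphism. -/
noncomputable def isoOfKerEmpty (q : Coll G H) (hq : ∀ e, e ∉ q.ker.carrier) : Iso G H where
  onV := Equiv.ofBijective q.onV ⟨fun u v h => (joined_empty hq).1 ((q.onV_eq u v).1 h),
    q.onV_surjective⟩
  onE := (Equiv.ofBijective q.lift (q.lift_bijective hq)).symm
  init_onE e := by
    obtain ⟨e', rfl⟩ := q.exists_lift e (hq e)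
    rw [Equiv.ofBijective_symm_apply_apply]
    exact (q.onV_init_lift e').symm
  rev_onE e := by
    obtain ⟨e', rfl⟩ := q.exists_lift e (hq e)
    rw [Equiv.ofBijective_symm_apply_apply, q.rev_lift, Equiv.ofBijective_symm_apply_apply]

theorem map_isoOfKerEmpty (q : Coll G H) (hq : ∀ e, e ∉ q.ker.carrier) :
    (q.isoOfKerEmpty hq).map = q.map := by
  refine map_unique _ (fun v => rfl) (fun e he => absurd he (hq e)) (fun e' t => ?_)
  have h : (q.isoOfKerEmpty hq).onE (q.lift e') = e' := Equiv.ofBijective_symm_apply_apply _ _ e'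
  exact congrArg (fun e => H.edgePt e t) h

/-! ### Connectivity, forests and separating edges under a collapse -/

/-- The preimage of a set of edges, together with the collapsed edges. -/
def pull (q : Coll G H) (A : Set H.E) : Set G.E :=
  {e | e ∈ q.ker.carrier ∨ ∃ e' ∈ A, q.lift e' = e}

theorem lift_mem_pull (q : Coll G H) {A : Set H.E} {e' : H.E} : q.lift e' ∈ q.pull A ↔ e' ∈ A := by
  constructor
  · rintro (h | ⟨e, he, h⟩)
    · exact absurd h (q.lift_notMem e')
    · rwa [← q.lift_injective h]
  · exact fun h => Or.inr ⟨e', h, rfl⟩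

/-- Edges of a path in `H` lift; consecutive lifts meet up to a path in the kernel. Conversely,
projecting a path merely drops its collapsed edges. -/
theorem joined_iff (q : Coll G H) {A : Set H.E} {u v : G.V} :
    H.Joined A (q.onV u) (q.onV v) ↔ G.Joined (q.pull A) u v := by
  constructor
  · intro h
    generalize hx : q.onV u = x at h
    induction h using Relation.ReflTransGen.head_induction_on generalizing u with
    | refl => exact ((q.onV_eq u v).1 hx).mono fun _ => Or.inl
    | head hab _ ih =>
      obtain ⟨e', he', rfl, rfl⟩ := hab
      rw [← q.onV_init_lift, q.onV_eq] at hx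
      exact (hx.mono fun _ => Or.inl).trans
        ((Joined.of_mem (q.lift_mem_pull.2 he')).trans (ih (q.onV_term_lift e')))
  · intro h
    induction h with
    | refl => exact Relation.ReflTransGen.refl
    | tail _ hbc ih =>
      obtain ⟨e, he | ⟨e', he', rfl⟩, rfl, rfl⟩ := hbc
      · rwa [← (q.onV_eq _ _).2 (Joined.of_mem he)]
      · rw [q.onV_init_lift] at ih
        rw [q.onV_term_lift]
        exact ih.trans (Joined.of_mem he')

theorem without_pull (q : Coll G H) (A : Set H.E) (e' : H.E) :
    q.pull (H.without A e') = G.without (q.pull A) (q.lift e') := by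
  ext a
  by_cases ha : a ∈ q.ker.carrier
  · have h₁ : a ≠ q.lift e' := fun h => q.lift_notMem e' (h ▸ ha)
    have h₂ : a ≠ q.lift (H.rev e') := fun h => q.lift_notMem _ (h ▸ ha)
    simp [pull, without, ha, q.rev_lift, h₁, h₂]
  · obtain ⟨b, rfl⟩ := q.exists_lift a ha
    rw [q.lift_mem_pull]
    simp only [without, Set.mem_ofPred_eq, q.lift_mem_pull, q.rev_lift, q.lift_injective.ne_iff]

theorem joined_without_iff (q : Coll G H) {A : Set H.E} {e' : H.E} :
    H.Joined (H.without A e') (H.init e') (H.term e') ↔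
      G.Joined (G.without (q.pull A) (q.lift e')) (G.init (q.lift e')) (G.term (q.lift e')) := by
  rw [← q.onV_init_lift, ← q.onV_term_lift, q.joined_iff, q.without_pull]

theorem pull_univ (q : Coll G H) : q.pull Set.univ = Set.univ := by
  ext e
  simp only [pull, Set.mem_ofPred_eq, Set.mem_univ, true_and, iff_true]
  exact or_iff_not_imp_left.2 (q.exists_lift e)

/-- The case of all edges in `joined_without_iff`. No forest hypothesis is needed: collapsing any
subgraph neither creates nor destroys separating edges among the survivors. -/
theorem isSeparating_iff (q : Coll G H) {e' : H.E} :
    H.IsSeparating e' ↔ G.IsSeparating (q.lift e') := by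
  rw [OGraph.isSeparating_iff, OGraph.isSeparating_iff, q.joined_without_iff, q.pull_univ]

/-- The composition of two collapses. -/
def trans (q : Coll G H) (r : Coll H K) : Coll G K where
  ker := ⟨q.pull r.ker.carrier, by
    rintro e (he | ⟨e', he', rfl⟩)
    · exact Or.inl (q.ker.rev_mem e he)
    · rw [q.rev_lift]
      exact q.lift_mem_pull.2 (r.ker.rev_mem e' he')⟩
  onV := r.onV ∘ q.onV
  lift := q.lift ∘ r.lift
  lift_injective := q.lift_injective.comp r.lift_injective
  exists_lift e he := by
    obtain ⟨e', rfl⟩ := q.exists_lift e fun h => he (Or.inl h)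
    obtain ⟨e'', rfl⟩ := r.exists_lift e' fun h => he (q.lift_mem_pull.2 h)
    exact ⟨e'', rfl⟩
  lift_notMem e := fun h => r.lift_notMem e (q.lift_mem_pull.1 h)
  onV_init_lift e := by simp [q.onV_init_lift, r.onV_init_lift]
  rev_lift e := by simp [q.rev_lift, r.rev_lift]
  onV_surjective := r.onV_surjective.comp q.onV_surjective
  onV_eq u v := (r.onV_eq _ _).trans q.joined_iff

theorem map_trans (q : Coll G H) (r : Coll H K) : r.map.comp q.map = (q.trans r).map := by
  refine map_unique _ (fun v => rfl) ?_ (fun e' t => ?_)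
  · rintro e (he | ⟨e', he', rfl⟩) t
    · rw [ContinuousMap.comp_apply, q.map_edgePt_of_mem he]
      rfl
    · rw [ContinuousMap.comp_apply, q.map_edgePt_lift, r.map_edgePt_of_mem he']
      simp [trans, q.onV_init_lift]
  · exact (congrArg r.map (q.map_edgePt_lift _ t)).trans (r.map_edgePt_lift e' t)

/-- A circuit in the composite kernel cannot lie wholly in `q.ker`, so it contains the lift of an
edge of `r.ker`; the rest of the circuit projects to a connection of the ends of that edge within
`r.ker`. -/
theorem isForest_trans (q : Coll G H) (r : Coll H K) (hq : G.IsForest q.ker)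
    (hr : H.IsForest r.ker) : G.IsForest (q.trans r).ker := by
  rintro ⟨l, hl, hlF, hc, hlast, hp⟩
  refine hq ⟨l, hl, fun e he => ?_, hc, hlast, hp⟩
  by_contra hne
  obtain ⟨e', rfl⟩ := q.exists_lift e hne
  refine isForest_iff.1 hr e' (q.lift_mem_pull.1 (hlF _ he)) ?_
  rw [q.joined_without_iff]
  exact joined_of_circuit hl hlF hc hlast hp he

theorem isForest_of_trans (q : Coll G H) (r : Coll H K) (h : G.IsForest (q.trans r).ker) :
    H.IsForest r.ker := by
  refine isForest_iff.2 fun e' he' hj => ?_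
  rw [q.joined_without_iff] at hj
  exact isForest_iff.1 h _ (q.lift_mem_pull.2 he') hj

/-- The kernel of the induced collapse, when `p` collapses more than `q` does. -/
def residualKer (q : Coll G H) (p : Coll G K) : H.EdgeSet where
  carrier := {e' | q.lift e' ∈ p.ker.carrier}
  rev_mem e' he' := by
    simp only [Set.mem_ofPred_eq, ← q.rev_lift]
    exact p.ker.rev_mem _ he'

theorem pull_residualKer (q : Coll G H) (p : Coll G K) (h : q.ker.carrier ⊆ p.ker.carrier) :
    q.pull (q.residualKer p).carrier = p.ker.carrier := by
  ext e
  by_cases he : e ∈ q.ker.carrier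
  · simp [pull, he, h he]
  · obtain ⟨e', rfl⟩ := q.exists_lift e he
    rw [q.lift_mem_pull]
    rfl

/-- A collapse factors through every collapse of a smaller subgraph. -/
theorem exists_factor (q : Coll G H) (p : Coll G K) (h : q.ker.carrier ⊆ p.ker.carrier) :
    ∃ r : Coll H K, q.trans r = p ∧ r.ker = q.residualKer p := by
  have hsec := Function.rightInverse_surjInv q.onV_surjective
  -- The fibres of `q` lie in fibres of `p`, so the choice of preimage does not matter.
  have hV : ∀ u, p.onV (Function.surjInv q.onV_surjective (q.onV u)) = p.onV u := fun u =>
    (p.onV_eq _ _).2 (((q.onV_eq _ _).1 (hsec _)).mono h)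
  have hE : ∀ k, ∃ e', q.lift e' = p.lift k := fun k =>
    q.exists_lift _ fun hk => p.lift_notMem k (h hk)
  choose lift hlift using hE
  refine ⟨{ ker := q.residualKer p
            onV := fun x => p.onV (Function.surjInv q.onV_surjective x)
            lift := lift
            lift_injective := fun a b hab => p.lift_injective (by rw [← hlift, ← hlift, hab])
            exists_lift := fun e' he' => ?_
            lift_notMem := fun k hk => p.lift_notMem k (by rw [← hlift]; exact hk)
            onV_init_lift := fun k => by
              rw [← q.onV_init_lift, hV, hlift, p.onV_init_lift]
            rev_lift := fun k => q.lift_injective (by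
              rw [← q.rev_lift, hlift, hlift, p.rev_lift])
            onV_surjective := fun z => ?_
            onV_eq := fun x y => ?_ }, ?_, rfl⟩
  · obtain ⟨k, hk⟩ := p.exists_lift _ he'
    exact ⟨k, q.lift_injective (by rw [hlift, hk])⟩
  · obtain ⟨u, rfl⟩ := p.onV_surjective z
    exact ⟨q.onV u, hV u⟩
  · obtain ⟨u, rfl⟩ := q.onV_surjective x
    obtain ⟨v, rfl⟩ := q.onV_surjective y
    rw [hV, hV, q.joined_iff, q.pull_residualKer p h, p.onV_eq]
  · refine Coll.ext (EdgeSet.ext fun e => ?_) (funext hV) (funext hlift)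
    exact Set.ext_iff.1 (q.pull_residualKer p h) e

end Coll

end OGraph

namespace OGraph

/-! ### Contraction of one edge -/

variable {G H K : OGraph}

open Classical in
/-- The vertex to which `x` is moved when the edge `a` is contracted to its terminal vertex. -/
noncomputable def push (G : OGraph) (a : G.E) (x : G.V) : G.V := if x = G.init a then G.term a else x

theorem push_init (a : G.E) : G.push a (G.init a) = G.term a := if_pos rfl

theorem push_of_ne {a : G.E} {x : G.V} (h : x ≠ G.init a) : G.push a x = x := if_neg h

theorem push_ne {a : G.E} (ha : G.init a ≠ G.term a) (x : G.V) : G.push a x ≠ G.init a := by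
  unfold push
  split_ifs with h
  · exact ha.symm
  · exact h

theorem push_term (a : G.E) : G.push a (G.term a) = G.term a := by
  unfold push
  split_ifs <;> rfl

/-- The graph obtained from `G` by contracting the edge `a`, which is not a loop. -/
noncomputable def contract (G : OGraph) (a : G.E) (ha : G.init a ≠ G.term a) : OGraph where
  V := {x : G.V // x ≠ G.init a}
  E := {e : G.E // e ≠ a ∧ e ≠ G.rev a}
  init e := ⟨G.push a (G.init e.1), push_ne ha _⟩
  rev e := ⟨G.rev e.1, fun h => e.2.2 ((G.rev_rev e.1).symm.trans (congrArg G.rev h)), fun h => e.2.1 (G.rev_injective h)⟩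
  rev_rev e := Subtype.ext (G.rev_rev e.1)
  rev_ne e h := G.rev_ne e.1 (congrArg Subtype.val h)

theorem joined_push (a : G.E) (x : G.V) : G.Joined {e | e = a ∨ e = G.rev a} x (G.push a x) := by
  unfold push
  split_ifs with h
  · rw [h]
    exact Joined.of_mem (Or.inl rfl)
  · exact Relation.ReflTransGen.refl

/-- The data of the contraction of an edge. -/
noncomputable def contractColl (G : OGraph) (a : G.E) (ha : G.init a ≠ G.term a) :
    Coll G (G.contract a ha) where
  ker := ⟨{e | e = a ∨ e = G.rev a}, by
    rintro e (rfl | rfl)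
    · exact Or.inr rfl
    · exact Or.inl (G.rev_rev a)⟩
  onV x := ⟨G.push a x, push_ne ha x⟩
  lift e := e.1
  lift_injective := Subtype.val_injective
  exists_lift e he := ⟨⟨e, not_or.1 he⟩, rfl⟩
  lift_notMem e := not_or.2 e.2
  onV_init_lift _ := rfl
  rev_lift _ := rfl
  onV_surjective x := ⟨x.1, Subtype.ext (push_of_ne x.2)⟩
  onV_eq u v := by
    have hS : ∀ e, e ∈ {e | e = a ∨ e = G.rev a} → G.rev e ∈ {e | e = a ∨ e = G.rev a} := by
      rintro e (rfl | rfl)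
      · exact Or.inr rfl
      · exact Or.inl (G.rev_rev a)
    constructor
    · intro h
      have h' : G.push a u = G.push a v := congrArg Subtype.val h
      refine (joined_push a u).trans ?_
      rw [h']
      exact (joined_push a v).symm hS
    · intro h
      refine Subtype.ext ?_
      induction h with
      | refl => rfl
      | tail _ hbc ih =>
        refine ih.trans ?_
        obtain ⟨e, rfl | rfl, rfl, rfl⟩ := hbc
        · exact (push_init _).trans (push_term _).symm
        · rw [term_rev]
          exact (push_term a).trans (push_init a).symm

/-- The merged vertex inherits at least two edge ends from each end point of `a`, hence at least
four; at every other vertex no edge end is lost. -/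
theorem three_le_valence_contract [Finite G.E] (hG : ∀ v, 3 ≤ G.valence v) (a : G.E)
    (ha : G.init a ≠ G.term a) (x : (G.contract a ha).V) : 3 ≤ (G.contract a ha).valence x := by
  have hG' : ∀ v, 3 ≤ {e | G.init e = v}.ncard := hG
  have hval : (G.contract a ha).valence x =
      {e | (e ≠ a ∧ e ≠ G.rev a) ∧ G.push a (G.init e) = x.1}.ncard := by
    refine Nat.card_congr ⟨fun e => ⟨e.1.1, e.1.2, congrArg Subtype.val e.2⟩,
      fun e => ⟨⟨e.1, e.2.1⟩, Subtype.ext e.2.2⟩, fun _ => rfl, fun _ => rfl⟩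
  rw [hval]
  obtain ⟨x, hx⟩ := x
  by_cases hxt : x = G.term a
  · have h₁ : 2 ≤ ({e | G.init e = G.init a} \ {a}).ncard := by
      rw [Set.ncard_sdiff_singleton_of_mem (by simp)]
      have := hG' (G.init a)
      omega
    have h₂ : 2 ≤ ({e | G.init e = G.term a} \ {G.rev a}).ncard := by
      rw [Set.ncard_sdiff_singleton_of_mem (by simp [term])]
      have := hG' (G.term a)
      omega
    have hd : Disjoint ({e | G.init e = G.init a} \ {a}) ({e | G.init e = G.term a} \ {G.rev a}) :=
      Set.disjoint_left.2 fun e h h' => ha (h.1.symm.trans h'.1)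
    have hu := Set.ncard_union_eq hd (Set.toFinite _) (Set.toFinite _)
    refine le_trans (by omega) (Set.ncard_le_ncard (s := ({e | G.init e = G.init a} \ {a}) ∪
      ({e | G.init e = G.term a} \ {G.rev a})) ?_ (Set.toFinite _))
    rintro e (⟨he, hea⟩ | ⟨he, hea⟩)
    · have he : G.init e = G.init a := he
      refine ⟨⟨hea, ?_⟩, by rw [he, push_init]; exact hxt.symm⟩
      rintro rfl
      exact ha he.symm
    · have he : G.init e = G.term a := he
      refine ⟨⟨?_, hea⟩, by rw [he, push_term]; exact hxt.symm⟩
      rintro rfl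
      exact ha he
  · refine (hG' x).trans (Set.ncard_le_ncard ?_ (Set.toFinite _))
    rintro e rfl
    refine ⟨⟨?_, ?_⟩, push_of_ne hx⟩
    · rintro rfl
      exact hx rfl
    · rintro rfl
      exact hxt rfl

/-! ### Contracting an edge is a homotopy equivalence -/

open Classical in
/-- The track of the vertex `x` while the edge `a` is contracted to its terminal vertex. -/
noncomputable def track (G : OGraph) (a : G.E) (x : G.V) (s : I) : G.Space :=
  if x = G.init a then G.edgePt a s else G.vertexPt x

theorem continuous_track (a : G.E) (x : G.V) : Continuous (G.track a x) := by
  unfold track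
  split_ifs
  · exact G.continuous_edgePt a
  · exact continuous_const

theorem track_zero (a : G.E) (x : G.V) : G.track a x 0 = G.vertexPt x := by
  unfold track
  split_ifs with h
  · rw [edgePt_zero, h]
  · rfl

theorem track_one (a : G.E) (x : G.V) : G.track a x 1 = G.vertexPt (G.push a x) := by
  unfold track push
  split_ifs with h
  · rw [edgePt_one]
  · rfl

/-- The edge `e`, parametrized by `[0, 1]`, prolonged at both ends by the tracks of its
end points. -/
noncomputable def longEdge (G : OGraph) (a e : G.E) (x : ℝ) : G.Space :=
  if x ≤ 0 then G.track a (G.init e) (Set.projIcc 0 1 zero_le_one (-x))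
  else if x ≤ 1 then G.edgePt e (Set.projIcc 0 1 zero_le_one x)
  else G.track a (G.term e) (Set.projIcc 0 1 zero_le_one (x - 1))

theorem projIcc_zero' : Set.projIcc (0 : ℝ) 1 zero_le_one 0 = 0 := Set.projIcc_left _
theorem projIcc_one' : Set.projIcc (0 : ℝ) 1 zero_le_one 1 = 1 := Set.projIcc_right _

theorem continuous_longEdge (a e : G.E) : Continuous (G.longEdge a e) := by
  unfold longEdge
  refine Continuous.if_le ?_ (Continuous.if_le ?_ ?_ continuous_id continuous_const ?_)
    continuous_id continuous_const ?_
  · exact (continuous_track a _).comp (continuous_projIcc.comp continuous_neg)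
  · exact (G.continuous_edgePt e).comp continuous_projIcc
  · exact (continuous_track a _).comp (continuous_projIcc.comp (continuous_id.sub continuous_const))
  · rintro x rfl
    rw [sub_self, projIcc_zero', projIcc_one', edgePt_one, track_zero]
  · rintro x rfl
    rw [neg_zero, projIcc_zero', track_zero, if_pos zero_le_one, edgePt_zero]

theorem longEdge_of_nonpos (a e : G.E) {x : ℝ} (hx : x ≤ 0) :
    G.longEdge a e x = G.track a (G.init e) (Set.projIcc 0 1 zero_le_one (-x)) := if_pos hx

theorem longEdge_coe (a e : G.E) (t : I) : G.longEdge a e t = G.edgePt e t := by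
  unfold longEdge
  split_ifs with h h'
  · obtain rfl : t = 0 := le_antisymm h t.2.1
    rw [show ((0 : I) : ℝ) = 0 from rfl, neg_zero, projIcc_zero', track_zero, edgePt_zero]
  · rw [Set.projIcc_val]
  · exact absurd t.2.2 h'

theorem longEdge_rev (a e : G.E) (x : ℝ) : G.longEdge a (G.rev e) x = G.longEdge a e (1 - x) := by
  rcases lt_trichotomy x 0 with h | rfl | h
  · rw [longEdge_of_nonpos _ _ h.le, longEdge, if_neg (by linarith), if_neg (by linarith)]
    congr 2
    ring
  · rw [sub_zero, show (0 : ℝ) = ((0 : I) : ℝ) from rfl, longEdge_coe,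
      show (1 : ℝ) = ((1 : I) : ℝ) from rfl, longEdge_coe, edgePt_zero, edgePt_one]
    rfl
  · rcases le_or_gt x 1 with h' | h'
    · have h₁ := longEdge_coe a (G.rev e) ⟨x, h.le, h'⟩
      have h₂ := longEdge_coe a e (σ ⟨x, h.le, h'⟩)
      refine h₁.trans (Eq.trans ?_ h₂.symm)
      rw [edgePt_rev, rev_rev]
    · rw [longEdge_of_nonpos a e (by linarith), longEdge, if_neg (by linarith),
        if_neg (by linarith), term_rev]
      congr 2
      ring

/-- The deformation of an edge `e` other than `a` while `a` is contracted. -/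
noncomputable def stretch (G : OGraph) (a e : G.E) : C(I × I, G.Space) where
  -- At time `s` the interval `[0, 1]` is spread affinely over `[-s, 1 + s]`, so the end points of
  -- `e` follow their tracks up to time `s`.
  toFun p := G.longEdge a e (p.1 * (1 + 2 * p.2) - p.2)
  continuous_toFun := (continuous_longEdge a e).comp (by fun_prop)

theorem stretch_rev (a e : G.E) (t s : I) :
    G.stretch a (G.rev e) (σ t, s) = G.stretch a e (t, s) := by
  simp only [stretch, ContinuousMap.coe_mk, longEdge_rev, unitInterval.coe_symm_eq]
  congr 1
  ring

theorem stretch_time_zero (a e : G.E) (t : I) : G.stretch a e (t, 0) = G.edgePt e t := by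
  rw [← longEdge_coe a]
  simp [stretch]

theorem stretch_zero (a e : G.E) (s : I) : G.stretch a e (0, s) = G.track a (G.init e) s := by
  have h : (-(s : ℝ)) ≤ 0 := neg_nonpos.2 s.2.1
  have h' := longEdge_of_nonpos a e h
  rw [neg_neg, Set.projIcc_val] at h'
  simpa [stretch] using h'

open Classical in
/-- The deformation of an edge while `a` is contracted. -/
noncomputable def deformEdge (G : OGraph) (a e : G.E) : C(I × I, G.Space) :=
  -- The points of `a` before parameter `s` are swept forward to `s`; those beyond stay put until
  -- they are reached.
  if e = a then ⟨fun p => G.edgePt a (max p.1 p.2), (G.continuous_edgePt a).comp (by fun_prop)⟩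
  else if e = G.rev a then
    ⟨fun p => G.edgePt a (max (σ p.1) p.2), (G.continuous_edgePt a).comp (by fun_prop)⟩
  else G.stretch a e

theorem deformEdge_self (a : G.E) (t s : I) :
    G.deformEdge a a (t, s) = G.edgePt a (max t s) := by
  rw [deformEdge, if_pos rfl]; rfl

theorem deformEdge_rev_self (a : G.E) (t s : I) :
    G.deformEdge a (G.rev a) (t, s) = G.edgePt a (max (σ t) s) := by
  rw [deformEdge, if_neg (G.rev_ne a), if_pos rfl]; rfl

theorem deformEdge_of_ne {a e : G.E} (h : e ≠ a ∧ e ≠ G.rev a) :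
    G.deformEdge a e = G.stretch a e := by
  rw [deformEdge, if_neg h.1, if_neg h.2]

/-- The deformation of `G` that contracts the edge `a`. -/
noncomputable def deform (G : OGraph) (a : G.E) (ha : G.init a ≠ G.term a) :
    C(G.Space, C(I, G.Space)) :=
  -- With paths as values, the homotopy comes from the universal property of the space of `G` alone,
  -- not of its product with `I`.
  G.desc (fun x => ⟨G.track a x, continuous_track a x⟩) (fun e t => (G.deformEdge a e).curry t)
    (fun e => (G.deformEdge a e).curry.continuous)
    (fun e => by
      ext s
      simp only [ContinuousMap.curry_apply, ContinuousMap.coe_mk]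
      by_cases h : e = a
      · subst h
        rw [deformEdge_self, max_eq_right unitInterval.nonneg', track, if_pos rfl]
      by_cases h' : e = G.rev a
      · subst h'
        rw [deformEdge_rev_self, unitInterval.symm_zero, max_eq_left unitInterval.le_one',
          edgePt_one, track, if_neg (fun hh => ha hh.symm)]
        rfl
      · rw [deformEdge_of_ne ⟨h, h'⟩, stretch_zero])
    (fun e t => by
      ext s
      simp only [ContinuousMap.curry_apply]
      by_cases h : e = a
      · subst h
        rw [deformEdge_self, deformEdge_rev_self, unitInterval.symm_symm]
      by_cases h' : e = G.rev a
      · subst h'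
        rw [deformEdge_rev_self, rev_rev, deformEdge_self]
      · have hr : G.rev e ≠ a ∧ G.rev e ≠ G.rev a :=
          ⟨fun hh => h' (by rw [← hh, rev_rev]), fun hh => h (G.rev_injective hh)⟩
        rw [deformEdge_of_ne ⟨h, h'⟩, deformEdge_of_ne hr, stretch_rev])

theorem deform_vertexPt (a : G.E) (ha : G.init a ≠ G.term a) (x : G.V) (s : I) :
    G.deform a ha (G.vertexPt x) s = G.track a x s := rfl

theorem deform_edgePt (a : G.E) (ha : G.init a ≠ G.term a) (e : G.E) (t s : I) :
    G.deform a ha (G.edgePt e t) s = G.deformEdge a e (t, s) := rfl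

/-- The homotopy inverse of the contraction of an edge. -/
noncomputable def expand (G : OGraph) (a : G.E) (ha : G.init a ≠ G.term a) :
    C((G.contract a ha).Space, G.Space) :=
  (G.contract a ha).desc (fun x => G.vertexPt x.1) (fun e t => G.stretch a e.1 (t, 1))
    (fun e => (G.stretch a e.1).continuous.comp (by fun_prop))
    (fun e => by rw [stretch_zero, track_one]; rfl)
    (fun e t => (stretch_rev a e.1 t 1).symm)

/-- Identifies the end of `deform` with the composite through the contracted graph, which makes
`deform` one half of the homotopy equivalence. -/
theorem expand_contract (a : G.E) (ha : G.init a ≠ G.term a) (x : G.Space) :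
    G.expand a ha ((G.contractColl a ha).map x) = G.deform a ha x 1 := by
  rcases G.space_cases x with ⟨v, rfl⟩ | ⟨e, t, rfl⟩
  · rw [deform_vertexPt, track_one]; rfl
  · rw [deform_edgePt]
    by_cases h : e = a
    · subst h
      rw [deformEdge_self, max_eq_right unitInterval.le_one', edgePt_one,
        Coll.map_edgePt_of_mem _ (Or.inl rfl)]
      exact congrArg G.vertexPt (push_init e)
    by_cases h' : e = G.rev a
    · subst h'
      rw [deformEdge_rev_self, max_eq_right unitInterval.le_one', edgePt_one,
        Coll.map_edgePt_of_mem _ (Or.inr rfl)]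
      exact congrArg G.vertexPt (push_term a)
    · rw [deformEdge_of_ne ⟨h, h'⟩]
      exact congrArg (G.expand a ha)
        ((G.contractColl a ha).map_edgePt_lift (⟨e, h, h'⟩ : (G.contract a ha).E) t)

theorem deform_zero (a : G.E) (ha : G.init a ≠ G.term a) (x : G.Space) :
    G.deform a ha x 0 = x := by
  rcases G.space_cases x with ⟨v, rfl⟩ | ⟨e, t, rfl⟩
  · rw [deform_vertexPt, track_zero]
  · rw [deform_edgePt]
    by_cases h : e = a
    · subst h
      rw [deformEdge_self, max_eq_left unitInterval.nonneg']
    by_cases h' : e = G.rev a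
    · subst h'
      rw [deformEdge_rev_self, max_eq_left unitInterval.nonneg', edgePt_rev,
        unitInterval.symm_symm]
    · rw [deformEdge_of_ne ⟨h, h'⟩, stretch_time_zero]

theorem contract_track (a : G.E) (ha : G.init a ≠ G.term a) (x : G.V) (s : I) :
    (G.contractColl a ha).map (G.track a x s) =
      (G.contract a ha).vertexPt ((G.contractColl a ha).onV x) := by
  unfold track
  split_ifs with h
  · rw [Coll.map_edgePt_of_mem _ (Or.inl rfl), h]
  · rfl

/-- The prolongations run inside `a` or are constant, so contraction turns them into waiting at the
ends: the parameter is clamped to `[0, 1]`. -/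
theorem contract_longEdge (a : G.E) (ha : G.init a ≠ G.term a) (e : (G.contract a ha).E) (x : ℝ) :
    (G.contractColl a ha).map (G.longEdge a e.1 x) =
      (G.contract a ha).edgePt e (Set.projIcc 0 1 zero_le_one x) := by
  unfold longEdge
  split_ifs with h h'
  · rw [contract_track, Set.projIcc_of_le_left _ h]
    exact (edgePt_zero _ _).symm
  · exact (G.contractColl a ha).map_edgePt_lift e _
  · rw [contract_track, Set.projIcc_of_right_le _ (not_le.1 h').le]
    refine Eq.trans ?_ (edgePt_one _ _).symm
    exact congrArg _ ((G.contractColl a ha).onV_term_lift e)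

/-- The contracted graph is deformed by reparametrizing its edges. -/
noncomputable def reparam (H : OGraph) : C(H.Space, C(I, H.Space)) :=
  H.desc (fun x => ContinuousMap.const I (H.vertexPt x))
    (fun e t => (⟨fun p => H.edgePt e (Set.projIcc 0 1 zero_le_one (p.1 * (1 + 2 * p.2) - p.2)),
      (H.continuous_edgePt e).comp (continuous_projIcc.comp (by fun_prop))⟩ :
        C(I × I, H.Space)).curry t)
    (fun _ => ContinuousMap.continuous _)
    (fun e => by
      ext s
      have h : ((0 : I) : ℝ) * (1 + 2 * s) - s ≤ 0 := by simpa using s.2.1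
      refine (congrArg (H.edgePt e) (Set.projIcc_of_le_left _ h)).trans ?_
      exact edgePt_zero _ _)
    (fun e t => by
      ext s
      simp only [ContinuousMap.curry_apply, ContinuousMap.coe_mk]
      rw [edgePt_rev]
      congr 1
      apply Subtype.ext
      simp only [unitInterval.coe_symm_eq, Set.coe_projIcc]
      have h : (1 - (t : ℝ)) * (1 + 2 * s) - s = 1 - (t * (1 + 2 * s) - s) := by ring
      rw [h]
      generalize (t : ℝ) * (1 + 2 * s) - s = x
      -- Clamping to `[0, 1]` commutes with `x ↦ 1 - x`.
      rcases le_total x 0 with h₀ | h₀ <;> rcases le_total x 1 with h₁ | h₁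
      · rw [min_eq_right h₁, max_eq_left h₀, min_eq_left (by linarith), max_eq_right (by linarith)]
        ring
      · linarith
      · rw [min_eq_right h₁, max_eq_right h₀, min_eq_right (by linarith),
          max_eq_right (by linarith)]
      · rw [min_eq_left h₁, max_eq_right zero_le_one, min_eq_right (by linarith),
          max_eq_left (by linarith)]
        ring)

theorem reparam_zero (H : OGraph) (x : H.Space) : H.reparam x 0 = x := by
  rcases H.space_cases x with ⟨v, rfl⟩ | ⟨e, t, rfl⟩
  · rfl
  · change H.edgePt e (Set.projIcc 0 1 zero_le_one _) = _
    congr 1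
    simp

theorem contract_expand (a : G.E) (ha : G.init a ≠ G.term a) (x : (G.contract a ha).Space) :
    (G.contractColl a ha).map (G.expand a ha x) = (G.contract a ha).reparam x 1 := by
  rcases (G.contract a ha).space_cases x with ⟨v, rfl⟩ | ⟨e, t, rfl⟩
  · exact congrArg (G.contract a ha).vertexPt (Subtype.ext (push_of_ne v.2))
  · exact contract_longEdge a ha e _

/-- A map into the path space gives a homotopy. -/
theorem homotopic_of_curry {X Y : Type*} [TopologicalSpace X] [TopologicalSpace Y] (k : C(X, C(I, Y)))
    {f g : C(X, Y)} (hf : ∀ x, k x 0 = f x) (hg : ∀ x, k x 1 = g x) : f.Homotopic g :=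
  ⟨{ toFun := fun p => k p.2 p.1
     continuous_toFun := by fun_prop
     map_zero_left := hf
     map_one_left := hg }⟩

/-- The contraction of an edge that is not a loop is a homotopy equivalence. -/
theorem exists_homotopyEquiv_contract (a : G.E) (ha : G.init a ≠ G.term a) :
    ∃ e : ContinuousMap.HomotopyEquiv G.Space (G.contract a ha).Space,
      e.toFun = (G.contractColl a ha).map :=
  ⟨{ toFun := (G.contractColl a ha).map
     invFun := G.expand a ha
     left_inv := (homotopic_of_curry (G.deform a ha) (deform_zero a ha)
       fun x => (expand_contract a ha x).symm).symm
     right_inv := (homotopic_of_curry (G.contract a ha).reparam (reparam_zero _)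
       fun x => (contract_expand a ha x).symm).symm }, rfl⟩

/-- Every forest of a finite graph with valences at least `3` can be collapsed; the result is a
homotopy equivalent finite graph with valences at least `3`. -/
theorem exists_coll [Finite G.V] [Finite G.E] (hG : ∀ v, 3 ≤ G.valence v) (F : G.EdgeSet)
    (hF : G.IsForest F) :
    ∃ (H : OGraph) (q : Coll G H), q.ker = F ∧ Finite H.V ∧ Finite H.E ∧
      (∀ v, 3 ≤ H.valence v) ∧
      ∃ e : ContinuousMap.HomotopyEquiv G.Space H.Space, e.toFun = q.map := by
  induction hN : Nat.card G.E using Nat.strong_induction_on generalizing G with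
  | _ N ih =>
    by_cases hne : ∃ a, a ∈ F.carrier
    · obtain ⟨a, haF⟩ := hne
      have ha := hF.init_ne_term haF
      set q := G.contractColl a ha with hq
      have hfinE : Finite (G.contract a ha).E := inferInstanceAs (Finite {e : G.E // _})
      have hfinV : Finite (G.contract a ha).V := inferInstanceAs (Finite {x : G.V // _})
      let F' : (G.contract a ha).EdgeSet :=
        ⟨{e | q.lift e ∈ F.carrier}, fun e he => by
          rw [Set.mem_ofPred_eq, ← q.rev_lift]; exact F.rev_mem _ he⟩
      -- `F` consists of `a`, its reverse and the lifts of `F'`; hence `F'` inherits the forest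
      -- property, and collapsing `a` and then `F'` collapses `F`.
      have hpull : q.pull F'.carrier = F.carrier := by
        ext e
        constructor
        · rintro ((rfl | rfl) | ⟨e', he', rfl⟩)
          · exact haF
          · exact F.rev_mem _ haF
          · exact he'
        · intro he
          refine or_iff_not_imp_left.2 fun h => ?_
          obtain ⟨e', rfl⟩ := q.exists_lift e h
          exact ⟨e', he, rfl⟩
      have hF' : (G.contract a ha).IsForest F' := isForest_iff.2 fun e' he' hj => by
        rw [q.joined_without_iff, hpull] at hj
        exact isForest_iff.1 hF _ he' hj
      have hlt : Nat.card (G.contract a ha).E < N := by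
        rw [← hN]
        exact Finite.card_subtype_lt (p := fun e : G.E => e ≠ a ∧ e ≠ G.rev a) (x := a)
          (fun h => h.1 rfl)
      obtain ⟨H, r, hr, hV, hE, hval, e, he⟩ :=
        ih _ hlt (three_le_valence_contract hG a ha) F' hF' rfl
      obtain ⟨e₀, he₀⟩ := exists_homotopyEquiv_contract a ha
      refine ⟨H, q.trans r, EdgeSet.ext fun b => ?_, hV, hE, hval, e₀.trans e, ?_⟩
      · rw [← hpull, ← hr]
        rfl
      · rw [← q.map_trans r, ← he, hq, ← he₀]
        rfl
    · push Not at hne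
      refine ⟨G, Coll.ofIso (Iso.refl G), EdgeSet.ext fun e => ?_, inferInstance, inferInstance,
        hG, ContinuousMap.HomotopyEquiv.refl _, ?_⟩
      · exact iff_of_false (Set.notMem_empty e) (hne e)
      · rw [← Coll.map_ofIso, Iso.map_refl]
        rfl

end OGraph

/-! ### The poset of marked graphs -/

namespace MarkedGraph

open OGraph

variable {n : ℕ} {X Y Z : MarkedGraph n}

/-- `q` collapses `X` to `Y`, compatibly with the markings up to homotopy. -/
def Compatible (X Y : MarkedGraph n) (q : Coll X.graph Y.graph) : Prop :=
  (q.map.comp X.marking).Homotopic Y.marking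

theorem Compatible.trans {q : Coll X.graph Y.graph} {r : Coll Y.graph Z.graph}
    (hq : X.Compatible Y q) (hr : Y.Compatible Z r) : X.Compatible Z (q.trans r) := by
  unfold Compatible
  rw [← Coll.map_trans, ContinuousMap.comp_assoc]
  exact (ContinuousMap.Homotopic.comp (ContinuousMap.Homotopic.refl r.map) hq).trans hr

theorem Compatible.of_trans {q : Coll X.graph Y.graph} {r : Coll Y.graph Z.graph}
    (hq : X.Compatible Y q) (h : X.Compatible Z (q.trans r)) : Y.Compatible Z r := by
  unfold Compatible at h
  rw [← Coll.map_trans, ContinuousMap.comp_assoc] at h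
  exact (ContinuousMap.Homotopic.comp (ContinuousMap.Homotopic.refl r.map) hq.symm).trans h

theorem isForestCollapse_iff {F : X.graph.EdgeSet} : X.IsForestCollapse F Y ↔
    X.graph.IsForest F ∧ ∃ q : Coll X.graph Y.graph, q.ker = F ∧ X.Compatible Y q := by
  refine and_congr_right fun _ => ⟨?_, ?_⟩
  · rintro ⟨h, hh⟩
    exact ⟨Coll.ofCollapseIso h, rfl, by rwa [Coll.map_ofCollapseIso] at hh⟩
  · rintro ⟨q, rfl, hq⟩
    exact ⟨q.toIso, hq⟩

theorem toVertex_eq_iff : X.toVertex = Y.toVertex ↔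
    ∃ q : Coll X.graph Y.graph, (∀ e, e ∉ q.ker.carrier) ∧ X.Compatible Y q := by
  refine Quotient.eq.trans ⟨?_, ?_⟩
  · rintro ⟨h, hh⟩
    exact ⟨Coll.ofIso h, fun e => Set.notMem_empty e, by rwa [Coll.map_ofIso] at hh⟩
  · rintro ⟨q, hq, hh⟩
    exact ⟨q.isoOfKerEmpty hq, by rwa [Coll.map_isoOfKerEmpty]⟩

theorem isForest_of_empty {G : OGraph} {F : G.EdgeSet} (hF : ∀ e, e ∉ F.carrier) : G.IsForest F :=
  isForest_iff.2 fun e he => absurd he (hF e)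

/-- The order may be tested on any representatives: changing them composes with collapses of empty
forests. -/
theorem toVertex_le_iff : Y.toVertex ≤ X.toVertex ↔
    ∃ q : Coll X.graph Y.graph, X.graph.IsForest q.ker ∧ X.Compatible Y q := by
  constructor
  · rintro ⟨X', Y', hX, hY, F, hF⟩
    obtain ⟨hF, q, rfl, hq⟩ := isForestCollapse_iff.1 hF
    obtain ⟨a, ha, ha'⟩ := toVertex_eq_iff.1 hX.symm
    obtain ⟨b, hb, hb'⟩ := toVertex_eq_iff.1 hY
    exact ⟨(a.trans q).trans b,
      Coll.isForest_trans _ _ (Coll.isForest_trans _ _ (isForest_of_empty ha) hF)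
        (isForest_of_empty hb), (ha'.trans hq).trans hb'⟩
  · rintro ⟨q, hF, hq⟩
    exact ⟨X, Y, rfl, rfl, q.ker, isForestCollapse_iff.2 ⟨hF, q, rfl, hq⟩⟩

/-- If `X` collapses to `Y` and, along a larger forest, to `Z`, then `Y` collapses to `Z`. -/
theorem le_of_ker_subset {q : Coll X.graph Y.graph} {p : Coll X.graph Z.graph}
    (hq : X.Compatible Y q) (hp : X.Compatible Z p) (hF : X.graph.IsForest p.ker)
    (h : q.ker.carrier ⊆ p.ker.carrier) : Z.toVertex ≤ Y.toVertex := by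
  obtain ⟨r, rfl, -⟩ := q.exists_factor p h
  exact toVertex_le_iff.2 ⟨r, Coll.isForest_of_trans q r hF, hq.of_trans hp⟩

theorem eq_of_ker_eq {q : Coll X.graph Y.graph} {p : Coll X.graph Z.graph}
    (hq : X.Compatible Y q) (hp : X.Compatible Z p) (h : q.ker.carrier = p.ker.carrier) :
    Y.toVertex = Z.toVertex := by
  obtain ⟨r, hr, hk⟩ := q.exists_factor p h.le
  subst hr
  refine toVertex_eq_iff.2 ⟨r, fun e he => q.lift_notMem e ?_, hq.of_trans hp⟩
  rw [h]
  exact q.lift_mem_pull.2 he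

theorem exists_isForestCollapse (X : MarkedGraph n) (F : X.graph.EdgeSet)
    (hF : X.graph.IsForest F) : ∃ Y : MarkedGraph n, X.IsForestCollapse F Y := by
  have := X.finite_V
  have := X.finite_E
  obtain ⟨H, q, hq, hV, hE, hval, e, he⟩ := exists_coll X.three_le_valence F hF
  obtain ⟨m, hm⟩ := X.marking_equiv
  exact ⟨⟨H, hV, hE, hval, q.map.comp X.marking, m.trans e, by rw [← he, ← hm]; rfl⟩,
    isForestCollapse_iff.2 ⟨hF, q, hq, ContinuousMap.Homotopic.refl _⟩⟩

/-- A marked graph obtained by collapsing all separating edges. -/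
noncomputable def collapseSep (X : MarkedGraph n) : MarkedGraph n :=
  (X.exists_isForestCollapse _ (isForest_sepEdges X.graph)).choose

theorem collapseSep_spec (X : MarkedGraph n) : X.IsForestCollapse X.graph.sepEdges X.collapseSep :=
  (X.exists_isForestCollapse _ (isForest_sepEdges X.graph)).choose_spec

theorem exists_collapseSep (X : MarkedGraph n) : ∃ q : Coll X.graph X.collapseSep.graph,
    q.ker = X.graph.sepEdges ∧ X.Compatible X.collapseSep q :=
  (isForestCollapse_iff.1 X.collapseSep_spec).2

/-- A separating edge of `X` is either collapsed in `Y` or still separating there. So the collapse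
`X → Y → Y.collapseSep` has a forest kernel containing all separating edges of `X`, and factors
through `X.collapseSep`. -/
theorem collapseSep_le_collapseSep (h : Y.toVertex ≤ X.toVertex) :
    Y.collapseSep.toVertex ≤ X.collapseSep.toVertex := by
  obtain ⟨q, hF, hq⟩ := toVertex_le_iff.1 h
  obtain ⟨r, hr, hr'⟩ := Y.exists_collapseSep
  obtain ⟨s, hs, hs'⟩ := X.exists_collapseSep
  refine le_of_ker_subset hs' (hq.trans hr') (Coll.isForest_trans q r hF ?_) fun e he => ?_
  · rw [hr]
    exact isForest_sepEdges _
  · refine or_iff_not_imp_left.2 fun hne => ?_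
    obtain ⟨e', rfl⟩ := q.exists_lift e hne
    rw [hs] at he
    refine ⟨e', ?_, rfl⟩
    rw [hr]
    exact q.isSeparating_iff.2 he

theorem collapseSep_congr (h : X.toVertex = Y.toVertex) :
    X.collapseSep.toVertex = Y.collapseSep.toVertex := by
  obtain ⟨q, hF, hq⟩ := toVertex_eq_iff.1 h
  obtain ⟨r, hr, hr'⟩ := Y.exists_collapseSep
  obtain ⟨s, hs, hs'⟩ := X.exists_collapseSep
  refine eq_of_ker_eq hs' (hq.trans hr') (Set.ext fun e => ?_)
  obtain ⟨e', rfl⟩ := q.exists_lift e (hF e)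
  refine Iff.trans ?_ q.lift_mem_pull.symm
  rw [hs, hr]
  exact q.isSeparating_iff.symm

theorem not_isSeparating_collapseSep (X : MarkedGraph n) (e : X.collapseSep.graph.E) :
    ¬ X.collapseSep.graph.IsSeparating e := by
  obtain ⟨q, hq, -⟩ := X.exists_collapseSep
  intro h
  apply q.lift_notMem e
  rw [hq]
  exact q.isSeparating_iff.1 h

theorem collapseSep_of_not_isSeparating (h : ∀ e, ¬ X.graph.IsSeparating e) :
    X.collapseSep.toVertex = X.toVertex := by
  obtain ⟨q, hq, hq'⟩ := X.exists_collapseSep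
  exact (toVertex_eq_iff.2 ⟨q, fun e => by rw [hq]; exact h e, hq'⟩).symm

theorem card_le_of_le (h : Y.toVertex ≤ X.toVertex) :
    Nat.card Y.graph.V ≤ Nat.card X.graph.V := by
  obtain ⟨q, -, -⟩ := toVertex_le_iff.1 h
  have := X.finite_V
  exact Nat.card_le_card_of_surjective q.onV q.onV_surjective

/-- An edge of a forest is not a loop, so collapsing it identifies two vertices; equal vertex counts
force the forest to be empty. -/
theorem eq_of_le_of_card_eq (h : Y.toVertex ≤ X.toVertex)
    (hc : Nat.card X.graph.V = Nat.card Y.graph.V) : X.toVertex = Y.toVertex := by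
  obtain ⟨q, hF, hq⟩ := toVertex_le_iff.1 h
  have := X.finite_V
  have := Y.finite_V
  have hb := (Nat.bijective_iff_surjective_and_card q.onV).2 ⟨q.onV_surjective, hc⟩
  exact toVertex_eq_iff.2 ⟨q, fun e he => hF.init_ne_term he
    (hb.1 ((q.onV_eq _ _).2 (Joined.of_mem he))), hq⟩

end MarkedGraph

/-! ### The collapse and the height on equivalence classes -/

namespace SpineVertex

variable {n : ℕ}

theorem exists_rep (x : SpineVertex n) : ∃ X : MarkedGraph n, X.toVertex = x := Quotient.exists_rep x

/-- Collapsing all separating edges. -/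
noncomputable def collapseSep : SpineVertex n → SpineVertex n :=
  Quotient.lift (fun X => X.collapseSep.toVertex)
    fun _ _ h => MarkedGraph.collapseSep_congr (Quotient.sound h)

/-- The number of vertices of a graph. -/
noncomputable def height : SpineVertex n → ℕ :=
  Quotient.lift (fun X => Nat.card X.graph.V) fun _ _ ⟨h, _⟩ => Nat.card_congr h.onV

protected theorem le_trans {x y z : SpineVertex n} (hxy : x ≤ y) (hyz : y ≤ z) : x ≤ z := by
  obtain ⟨X, rfl⟩ := exists_rep x
  obtain ⟨Y, rfl⟩ := exists_rep y
  obtain ⟨Z, rfl⟩ := exists_rep z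
  obtain ⟨q, hF, hq⟩ := MarkedGraph.toVertex_le_iff.1 hxy
  obtain ⟨r, hF', hr⟩ := MarkedGraph.toVertex_le_iff.1 hyz
  exact MarkedGraph.toVertex_le_iff.2 ⟨r.trans q, OGraph.Coll.isForest_trans r q hF' hF, hr.trans hq⟩

theorem collapseSep_mono {x y : SpineVertex n} (h : x ≤ y) : collapseSep x ≤ collapseSep y := by
  obtain ⟨X, rfl⟩ := exists_rep x
  obtain ⟨Y, rfl⟩ := exists_rep y
  exact MarkedGraph.collapseSep_le_collapseSep h

theorem collapseSep_le (x : SpineVertex n) : collapseSep x ≤ x := by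
  obtain ⟨X, rfl⟩ := exists_rep x
  exact ⟨X, X.collapseSep, rfl, rfl, _, X.collapseSep_spec⟩

theorem collapseSep_mem (x : SpineVertex n) : collapseSep x ∈ nonsepVertices n := by
  obtain ⟨X, rfl⟩ := exists_rep x
  exact ⟨X.collapseSep, rfl, X.not_isSeparating_collapseSep⟩

theorem collapseSep_of_mem {x : SpineVertex n} (hx : x ∈ nonsepVertices n) : collapseSep x = x := by
  obtain ⟨X, rfl, h⟩ := hx
  exact MarkedGraph.collapseSep_of_not_isSeparating h

theorem range_collapseSep : Set.range (collapseSep (n := n)) = nonsepVertices n :=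
  Set.Subset.antisymm (Set.range_subset_iff.2 collapseSep_mem)
    fun x hx => ⟨x, collapseSep_of_mem hx⟩

theorem height_mono {x y : SpineVertex n} (h : x ≤ y) : height x ≤ height y := by
  obtain ⟨X, rfl⟩ := exists_rep x
  obtain ⟨Y, rfl⟩ := exists_rep y
  exact MarkedGraph.card_le_of_le h

theorem eq_of_le_of_height_eq {x y : SpineVertex n} (h : x ≤ y) (hh : height x = height y) :
    x = y := by
  obtain ⟨X, rfl⟩ := exists_rep x
  obtain ⟨Y, rfl⟩ := exists_rep y
  exact (MarkedGraph.eq_of_le_of_card_eq h hh.symm).symm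

end SpineVertex

/-! ### Continuity of maps between realizations -/

namespace Realization

variable {ι : Type*} {K : AbstractSimplicialComplex ι}

/-- A closed simplex of a realization, with the topology of the barycentric coordinates. -/
def Face (K : AbstractSimplicialComplex ι) (s : Finset ι) : Type _ :=
  {x : Realization K // x.weight.support ⊆ s}

/-- A point of a closed simplex. -/
def Face.mk {s : Finset ι} (x : Realization K) (hx : x.weight.support ⊆ s) : Face K s := ⟨x, hx⟩

instance (s : Finset ι) : TopologicalSpace (Face K s) :=
  TopologicalSpace.induced (fun x => (⇑x.1.weight : ι → ℝ)) inferInstance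

theorem continuous_iff_face {Y : Type*} [TopologicalSpace Y] {φ : Realization K → Y} :
    Continuous φ ↔ ∀ s ∈ K.faces, Continuous fun x : Face K s => φ x.1 := by
  refine continuous_iSup_dom.trans (forall_congr' fun s => ?_)
  exact continuous_iSup_dom.trans (forall_congr' fun _ => continuous_coinduced_dom)

theorem continuous_face_val {s : Finset ι} (hs : s ∈ K.faces) :
    Continuous fun x : Face K s => x.1 := continuous_iff_face.1 continuous_id s hs

theorem continuous_face_weight (s : Finset ι) (i : ι) :
    Continuous fun x : Face K s => x.1.weight i :=
  (continuous_apply i).comp continuous_induced_dom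

/-- A map into a realization is continuous if it meets only finitely many simplices and if its
barycentric coordinates are continuous. -/
theorem continuous_of_weight {Z : Type*} [TopologicalSpace Z] {φ : Z → Realization K}
    (T : Finset ι) (hT : ∀ z, (φ z).weight.support ⊆ T)
    (hφ : ∀ i, Continuous fun z => (φ z).weight i) : Continuous φ := by
  classical
  -- The source is covered by finitely many closed sets, one for each simplex within `T`; on each,
  -- the map factors through a closed simplex with its coordinate topology.
  let C : {s // s ∈ T.powerset ∧ s ∈ K.faces} → Set Z := fun s => {z | (φ z).weight.support ⊆ s.1}
  have : Finite {s // s ∈ T.powerset ∧ s ∈ K.faces} :=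
    (T.powerset.finite_toSet.subset fun _ h => h.1).to_subtype
  refine (locallyFinite_of_finite C).continuous ?_ (fun s => ?_) (fun s => ?_)
  · refine Set.eq_univ_of_forall fun z => Set.mem_iUnion.2 ?_
    exact ⟨⟨(φ z).weight.support, Finset.mem_powerset.2 (hT z), (φ z).support_mem⟩,
      Finset.Subset.refl _⟩
  · have h : C s = ⋂ i ∈ {i | i ∉ s.1}, {z | (φ z).weight i = 0} := by
      ext z
      simp only [C, Set.mem_ofPred_eq, Set.mem_iInter, Finset.subset_iff, Finsupp.mem_support_iff]
      exact forall_congr' fun i => not_imp_comm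
    rw [h]
    exact isClosed_biInter fun i _ => isClosed_eq (hφ i) continuous_const
  · rw [continuousOn_iff_continuous_domRestrict]
    have hw : Continuous ((fun x : Face K s.1 => (⇑x.1.weight : ι → ℝ)) ∘
        fun z : C s => (Face.mk (φ z.1) z.2 : Face K s.1)) :=
      continuous_pi fun i => (hφ i).comp continuous_subtype_val
    have h : Continuous fun z : C s => (Face.mk (φ z.1) z.2 : Face K s.1) := continuous_induced_rng.2 hw
    exact (continuous_face_val s.2.2).comp h

end Realization

/-! ### Sliding the vertices of a chain along a poset map -/

section Slide

variable {P : Type*}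

/-- The weights that result from moving the fraction `c p` of the weight of each `p` to `f p`. -/
noncomputable def slide (f : P → P) (c : P → ℝ) (w : P →₀ ℝ) : P →₀ ℝ :=
  w.sum fun p a => Finsupp.single p ((1 - c p) * a) + Finsupp.single (f p) (c p * a)

theorem slide_apply (f : P → P) (c : P → ℝ) (w : P →₀ ℝ) (q : P) :
    slide f c w q =
      w.sum fun p a => Finsupp.single p ((1 - c p) * a) q + Finsupp.single (f p) (c p * a) q := by
  rw [slide, Finsupp.sum_apply]
  rfl

theorem slide_nonneg {f : P → P} {c : P → ℝ} {w : P →₀ ℝ} (hc : ∀ p, c p ∈ Set.Icc (0 : ℝ) 1)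
    (hw : ∀ p, 0 ≤ w p) (q : P) : 0 ≤ slide f c w q := by
  classical
  rw [slide_apply]
  refine Finset.sum_nonneg fun p _ => ?_
  have h₁ := mul_nonneg (sub_nonneg.2 (hc p).2) (hw p)
  have h₂ := mul_nonneg (hc p).1 (hw p)
  simp only [Finsupp.single_apply]
  split_ifs <;> simp [h₁, h₂, add_nonneg]

theorem slide_sum (f : P → P) (c : P → ℝ) (w : P →₀ ℝ) :
    ((slide f c w).sum fun _ a => a) = w.sum fun _ a => a := by
  rw [slide, Finsupp.sum_sum_index (fun _ => rfl) (fun _ _ _ => rfl)]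
  refine Finsupp.sum_congr fun p _ => ?_
  rw [Finsupp.sum_add_index' (fun _ => rfl) (fun _ _ _ => rfl), Finsupp.sum_single_index rfl,
    Finsupp.sum_single_index rfl]
  ring

/-- The conditions `c p ≠ 1` and `c p ≠ 0` record that `p` is not fully moved, or has begun to move;
the chain argument depends on them. -/
theorem exists_of_mem_support_slide {f : P → P} {c : P → ℝ} {w : P →₀ ℝ} {q : P}
    (h : q ∈ (slide f c w).support) :
    ∃ p ∈ w.support, (q = p ∧ c p ≠ 1) ∨ (q = f p ∧ c p ≠ 0) := by
  classical
  rw [Finsupp.mem_support_iff, slide_apply] at h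
  obtain ⟨p, hp, hne⟩ := Finset.exists_ne_zero_of_sum_ne_zero h
  refine ⟨p, hp, ?_⟩
  by_contra! hcon
  refine hne ?_
  simp only [Finsupp.single_apply]
  split_ifs with h₁ h₂ h₂
  · exact absurd ((hcon.1 h₁.symm).symm.trans (hcon.2 h₂.symm)) one_ne_zero
  · simp [hcon.1 h₁.symm]
  · simp [hcon.2 h₂.symm]
  · simp

theorem slide_eq_self {f : P → P} {c : P → ℝ} {w : P →₀ ℝ}
    (h : ∀ p ∈ w.support, c p = 0 ∨ f p = p) : slide f c w = w := by
  conv_rhs => rw [← w.sum_single]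
  refine Finsupp.sum_congr fun p hp => ?_
  rcases h p hp with h | h
  · simp [h]
  · rw [h, ← Finsupp.single_add]
    congr 1
    ring

theorem slide_one (f : P → P) (w : P →₀ ℝ) : slide f (fun _ => 1) w = w.mapDomain f := by
  simp [slide, Finsupp.mapDomain]

theorem support_slide_subset [DecidableEq P] {f : P → P} {c : P → ℝ} {w : P →₀ ℝ} {s : Finset P}
    (hs : w.support ⊆ s) : (slide f c w).support ⊆ s ∪ s.image f := by
  intro q hq
  obtain ⟨p, hp, ⟨rfl, -⟩ | ⟨rfl, -⟩⟩ := exists_of_mem_support_slide hq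
  · exact Finset.mem_union_left _ (hs hp)
  · exact Finset.mem_union_right _ (Finset.mem_image_of_mem f (hs hp))

/-- The fraction of the weight at height `k` that has been moved at time `t`: nothing until the
time `k / (k + 1)`, and everything from the time `(k + 1) / (k + 2)` on. -/
noncomputable def ramp (k : ℕ) (t : I) : ℝ := max 0 (min 1 ((t * (k + 1) - k) * (k + 2)))

theorem ramp_mem (k : ℕ) (t : I) : ramp k t ∈ Set.Icc (0 : ℝ) 1 :=
  ⟨le_max_left _ _, max_le zero_le_one (min_le_left _ _)⟩

theorem continuous_ramp (k : ℕ) : Continuous (ramp k) := by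
  unfold ramp
  fun_prop

theorem ramp_zero (k : ℕ) : ramp k 0 = 0 := by
  refine max_eq_left ((min_le_right _ _).trans ?_)
  rw [Set.Icc.coe_zero, zero_mul, zero_sub, neg_mul]
  exact neg_nonpos.2 (by positivity)

theorem ramp_one (k : ℕ) : ramp k 1 = 1 := by
  have h : (1 : ℝ) ≤ (((1 : I) : ℝ) * (k + 1) - k) * (k + 2) := by
    have := Nat.cast_nonneg (α := ℝ) k
    rw [Set.Icc.coe_one]
    linarith
  rw [ramp, min_eq_left h, max_eq_right zero_le_one]

/-- Lower weights are moved completely before higher ones start to move. -/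
theorem ramp_eq_one_of_lt {j k : ℕ} (hjk : j < k) {t : I} (hk : ramp k t ≠ 0) : ramp j t = 1 := by
  have ht := t.2.2
  have hj : (0 : ℝ) ≤ j := j.cast_nonneg
  have hjk' : (j : ℝ) + 1 ≤ k := by exact_mod_cast hjk
  have hpos : (k : ℝ) < t * (k + 1) := by
    by_contra! hcon
    refine hk (max_eq_left ((min_le_right _ _).trans ?_))
    exact mul_nonpos_of_nonpos_of_nonneg (by linarith) (by linarith)
  -- By `hpos`, `(1 - t) * (k + 1) < 1`. As `j + 2 ≤ k + 1`, this gives `t > (j + 1) / (j + 2)`, the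
  -- time when height `j` is finished.
  have h₁ : (1 - (t : ℝ)) * (j + 2) ≤ (1 - t) * (k + 1) :=
    mul_le_mul_of_nonneg_left (by linarith) (by linarith)
  have h₂ : (0 : ℝ) ≤ (j + 1) * (t * (j + 2) - (j + 1)) :=
    mul_nonneg (by linarith) (by linarith)
  have h : (1 : ℝ) ≤ (t * (j + 1) - j) * (j + 2) := by linarith
  rw [ramp, min_eq_left h, max_eq_right zero_le_one]

theorem continuous_slide_apply {Z : Type*} [TopologicalSpace Z] {f : P → P} {c : Z → P → ℝ}
    {w : Z → P →₀ ℝ} {s : Finset P} (hs : ∀ z, (w z).support ⊆ s)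
    (hc : ∀ p, Continuous fun z => c z p) (hw : ∀ p, Continuous fun z => w z p) (q : P) :
    Continuous fun z => slide f (c z) (w z) q := by
  classical
  have heq : (fun z => slide f (c z) (w z) q) = fun z => ∑ p ∈ s,
      ((if p = q then (1 - c z p) * w z p else 0) + if f p = q then c z p * w z p else 0) := by
    funext z
    rw [slide_apply]
    simp only [Finsupp.single_apply]
    exact Finsupp.sum_of_support_subset _ (hs z) _ (by simp)
  rw [heq]
  refine continuous_finsetSum _ fun p _ => ?_
  have h₁ := hc p
  have h₂ := hw p
  split_ifs <;> fun_prop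

variable [LE P] {f : P → P} {ht : P → ℕ}

/-- Unmoved vertices form a chain, and so do images by monotonicity; only an image against an
unmoved vertex needs the schedule. -/
theorem slide_support_mem (htrans : ∀ x y z : P, x ≤ y → y ≤ z → x ≤ z)
    (hmono : ∀ x y : P, x ≤ y → f x ≤ f y) (hle : ∀ x, f x ≤ x)
    (hht : ∀ x y : P, x ≤ y → ht x ≤ ht y) (hstrict : ∀ x y : P, x ≤ y → ht x = ht y → x = y)
    (x : Realization (orderComplex P)) (t : I) :
    (slide f (fun p => ramp (ht p) t) x.weight).support ∈ (orderComplex P).faces := by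
  obtain ⟨hne, hch⟩ := x.support_mem
  refine ⟨?_, ?_⟩
  · rw [Finsupp.support_nonempty_iff]
    intro h
    have := slide_sum f (fun p => ramp (ht p) t) x.weight
    rw [h, x.sum_eq_one] at this
    simp at this
  · have key : ∀ p ∈ x.weight.support, ∀ p' ∈ x.weight.support, ramp (ht p) t ≠ 1 →
        ramp (ht p') t ≠ 0 → f p' ≤ p := by
      intro p hp p' hp' h₁ h₀
      by_cases heq : p = p'
      · rw [heq]
        exact hle p'
      -- If `p` were strictly lower, it would be fully moved before `p'` starts.
      have hhle : ht p' ≤ ht p := not_lt.1 fun hlt => h₁ (ramp_eq_one_of_lt hlt h₀)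
      -- Heights exclude `p < p'`, so `p' ≤ p` in the chain.
      rcases hch hp hp' heq with h | h
      · exact absurd (hstrict p p' h (le_antisymm (hht _ _ h) hhle)) heq
      · exact htrans _ _ _ (hle p') h
    intro a ha b hb hab
    obtain ⟨p, hp, ⟨rfl, hp₁⟩ | ⟨rfl, hp₀⟩⟩ := exists_of_mem_support_slide ha <;>
      obtain ⟨p', hp', ⟨rfl, hp'₁⟩ | ⟨rfl, hp'₀⟩⟩ := exists_of_mem_support_slide hb
    · exact hch hp hp' hab
    · exact Or.inr (key _ hp _ hp' hp₁ hp'₀)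
    · exact Or.inl (key _ hp' _ hp hp'₁ hp₀)
    · exact (hch hp hp' fun h => hab (congrArg f h)).imp (hmono _ _) (hmono _ _)

/-- A monotone map `f ≤ id` of a poset with a height function that fixes its image `A` pointwise
gives a deformation retraction of the realization of the order complex onto the subcomplex
spanned by `A`. -/
theorem exists_deformationRetraction {A : Set P} (htrans : ∀ x y z : P, x ≤ y → y ≤ z → x ≤ z)
    (hmono : ∀ x y : P, x ≤ y → f x ≤ f y) (hle : ∀ x, f x ≤ x)
    (hht : ∀ x y : P, x ≤ y → ht x ≤ ht y) (hstrict : ∀ x y : P, x ≤ y → ht x = ht y → x = y)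
    (hA : ∀ x, f x ∈ A) (hfix : ∀ x ∈ A, f x = x) :
    ∃ D : DeformationRetraction (Realization (orderComplex P))
        (spannedSubcomplex (orderComplex P) A),
      ∀ x, (D.H (1, x)).weight = x.weight.mapDomain f := by
  classical
  let φ : Realization (orderComplex P) → I → Realization (orderComplex P) := fun x t =>
    { weight := slide f (fun p => ramp (ht p) t) x.weight
      nonneg := slide_nonneg (fun p => ramp_mem _ t) x.nonneg
      sum_eq_one := (slide_sum _ _ _).trans x.sum_eq_one
      support_mem := slide_support_mem htrans hmono hle hht hstrict x t }
  have hφ : ∀ x t, (φ x t).weight = slide f (fun p => ramp (ht p) t) x.weight := fun _ _ => rfl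
  clear_value φ
  have hface : ∀ s ∈ (orderComplex P).faces,
      Continuous fun p : Realization.Face (orderComplex P) s × I => φ p.1.1 p.2 := by
    intro s _
    refine Realization.continuous_of_weight (s ∪ s.image f) (fun p => ?_) fun q => ?_
    · rw [hφ]
      exact support_slide_subset p.1.2
    · simp only [hφ]
      exact continuous_slide_apply (fun p => p.1.2) (fun i => (continuous_ramp _).comp continuous_snd)
        (fun i => (Realization.continuous_face_weight s i).comp continuous_fst) q
  have hpath : ∀ x, Continuous (φ x) := fun x =>
    (hface _ x.support_mem).comp
      (Continuous.prodMk_right (Realization.Face.mk x (Finset.Subset.refl x.weight.support)))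
  let Φ : Realization (orderComplex P) → C(I, Realization (orderComplex P)) :=
    fun x => ⟨φ x, hpath x⟩
  -- The weak topology tests maps out of the realization itself, not out of its product with `I`.
  -- Hence the homotopy is curried, checked on faces, and uncurried, which local compactness of `I`
  -- allows.
  have hΦ : Continuous Φ := Realization.continuous_iff_face.2 fun s hs =>
    ContinuousMap.continuous_of_continuous_uncurry _ (hface s hs)
  have hH : Continuous fun p : I × Realization (orderComplex P) => φ p.2 p.1 :=
    (ContinuousMap.continuous_uncurry_of_continuous ⟨Φ, hΦ⟩).comp continuous_swap
  refine ⟨{ H := ⟨fun p => φ p.2 p.1, hH⟩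
            at_zero := fun x => Realization.ext ?_
            at_one_mem := fun x q hq => ?_
            fixed := fun t x hx => Realization.ext ?_ }, fun x => ?_⟩
  · exact (hφ x 0).trans (slide_eq_self fun p _ => Or.inl (ramp_zero _))
  · have hq' : q ∈ (φ x 1).weight.support := hq
    rw [hφ] at hq'
    obtain ⟨p, -, ⟨-, h⟩ | ⟨rfl, -⟩⟩ := exists_of_mem_support_slide hq'
    · exact absurd (ramp_one _) h
    · exact hA p
  · exact (hφ x t).trans (slide_eq_self fun p hp => Or.inr (hfix p (hx hp)))
  · refine (hφ x 1).trans ?_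
    simp only [ramp_one]
    exact slide_one f x.weight

end Slide

theorem mainTheorem9 (n : ℕ) :
    ∃ f : SpineVertex n → SpineVertex n,
      (∀ X : MarkedGraph n, ∃ Y : MarkedGraph n,
        f X.toVertex = Y.toVertex ∧ X.IsForestCollapse X.graph.sepEdges Y) ∧
      (∀ x y, x ≤ y → f x ≤ f y) ∧
      (∀ x, f x ≤ x) ∧
      Set.range f = nonsepVertices n ∧
      ∃ D : DeformationRetraction (Spine n) (nonsepSpine n),
        ∀ x, (D.H (1, x)).weight = x.weight.mapDomain f :=
  ⟨SpineVertex.collapseSep, fun X => ⟨X.collapseSep, rfl, X.collapseSep_spec⟩,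
    fun _ _ => SpineVertex.collapseSep_mono, SpineVertex.collapseSep_le,
    SpineVertex.range_collapseSep,
    exists_deformationRetraction (ht := SpineVertex.height)
      (fun _ _ _ => SpineVertex.le_trans) (fun _ _ => SpineVertex.collapseSep_mono)
      SpineVertex.collapseSep_le (fun _ _ => SpineVertex.height_mono)
      (fun _ _ => SpineVertex.eq_of_le_of_height_eq) SpineVertex.collapseSep_mem
      fun _ => SpineVertex.collapseSep_of_mem⟩
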